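/- **The noncommutative linear plethystic bialgebra.** Let $W$ be the set of nonempty finite words $\omega=\omega_1\cdots\omega_n$ of positive integers, $|\omega|=n$, and for $k\ge 1$ put $k\omega=(k\omega_1)\cdots(k\omega_n)$. Let $R$ be a unital, not necessarily commutative ring. For power series without constant term in noncommuting variables $x_1,x_2,\dots$ (commuting with the coefficients), $F=\sum_{\omega\in W}F_\omega x_{\omega_1}\cdots x_{\omega_n}$ and $G$ likewise, with coefficients in $R$, put $F_k=F(x_k,x_{2k},\dots)$ and $$G\circledast F=G(F_1,F_2,\dots)=\sum_{\omega\in W}G_\omega F_{\omega_1}\cdots F_{\omega_n}.$$ Let $\mathcal P^{\diamondsuit,\mathrm{nc}}_{\mathrm{lin}}=\mathbb Q\langle a_\omega:\omega\in W\rangle$ be the free associative unital algebra. Its comultiplication is the algebra map for which $\Delta(a_\nu)$ is the coefficient of $\nu$ in $G\circledast F$, where $F=\sum_\omega (a_\omega\otimes 1)x_\omega$ and $G=\sum_\omega(1\otimes a_\omega)x_\omega$ are the generic series over $\mathcal P\otimes\mathcal P$; its counit is the algebra map sending $a_\nu$ to the coefficient of $\nu$ in the series $x_1$. **The operad and its bar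 construction.** Let $\mathsf M^r$ be the free semigroup monad and $\mathsf M$ the free monoid monad, on sets. An $\mathsf M^r$-operad is a coloured nonsymmetric operad without nullary operations. Let $\mathsf{Ass}$ be the terminal one (one colour and one operation of each arity $n\ge1$). To an $\mathsf M^r$-operad $Q$ one associates the category with objects the colours and arrows $a\to b$ the operations of output $b$ with all inputs equal to $a$, the composite of $f$ followed by $g$ being $g\circ(f,\dots,f)$. To a category $C$ one associates the $\mathsf M^r$-operad with colours the objects and operations the nonempty sequences $x=(x_1,\dots,x_k)$ of arrows with a common target (the inputs are the sources and the output is the target), with composition $x\circ(y^1,\dots,y^k)=(x_1\circ y^1_1,\dots,x_1\circ y^1_{n_1},\dots,x_k\circ y^k_{n_k})$. Let $T^{\mathsf M^r}\mathsf{Ass}$ be the operad associated to the category associated to $\mathsf{Ass}$; its operations are the tuples $(m_1,\dots,m_n)$, $n\geq 1$, of positive integers, that is, the elements of $W$. Let $X=\mathcal B\,T^{\mathsf M^r}\mathsf{Ass}$ be its two-sided bar construction over $\mathsf M$ (along $\mathsf M^r\Rightarrow\mathsf M$): $X_n$ is the set of finite, possibly empty, sequences of trees of operations of height $n$; $d_0$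 removes the level furthest from the root, the inner faces compose adjacent levels, $d_n$ removes the root level, and the degeneracies insert units. It is a simplicial set with a levelwise monoid structure (juxtaposition), and is regarded as a discrete simplicial groupoid. **The homotopy cardinality of the incidence bialgebra** of a locally finite simplicial groupoid $X$ with a levelwise monoidal structure is the $\mathbb Q$-vector space spanned by the classes $\delta_f$, $f\in\pi_0X_1$, with product induced by the monoidal structure, comultiplication $\Delta(\delta_f)=\bigl|(X_2)_f\xrightarrow{(d_2,d_0)}X_1\times X_1\bigr|$, where $(X_2)_f$ is the homotopy fibre of $d_1:X_2\to X_1$ over $f$, and counit $\varepsilon(\delta_f)=|(X_0)_f|$, the homotopy cardinality of the homotopy fibre of $s_0:X_0\to X_1$ over $f$. The cardinality of a map $p:A\to B$ of groupoids is $\sum_{b\in\pi_0B}\frac{|A_b|}{|\mathrm{Aut}\,b|}\delta_b$, with $A_b$ the homotopy fibre. Locally finite means that $X_1$ has finite automorphism groups and that $s_0:X_0\to X_1$ and $d_1:X_2\to X_1$ have finite homotopy fibres. **Theorem.** 1. $\mathcal B\,T^{\mathsf M^r}\mathsf{Ass}$ is locally finite, and both $\mathcal P^{\diamondsuit,\mathrm{nc}}_{\mathrm{lin}}$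 and the homotopy cardinality of the incidence bialgebra of $\mathcal B\,T^{\mathsf M^r}\mathsf{Ass}$ are bialgebras (coassociative and counital, with multiplicative and unital comultiplication and counit). 2. There is an isomorphism of bialgebras from $\mathcal P^{\diamondsuit,\mathrm{nc}}_{\mathrm{lin}}$ to the homotopy cardinality of the incidence bialgebra of $\mathcal B\,T^{\mathsf M^r}\mathsf{Ass}$ that sends $a_\omega$ to the class $\delta_\omega$ of the one-term sequence formed by the tuple $\omega$. 3. For every $\nu\in W$, there are finitely many pairs $(\omega,\kappa)$ with $\omega\in W$ and $\kappa=(\kappa_1,\dots,\kappa_{|\omega|})$ a sequence of $|\omega|$ words in $W$ such that $\nu$ is the concatenation $\omega_1\kappa_1+\dots+\omega_{|\omega|}\kappa_{|\omega|}$, and $$\Delta(a_\nu)=\sum_{(\omega,\kappa)\,:\,\nu=\sum_i\omega_i\kappa_i}\Bigl(\prod_{i=1}^{|\omega|}a_{\kappa_i}\Bigr)\otimes a_\omega,$$ with the product taken in order. 4. $\Delta$ is the comultiplication induced by substitution: for every $\mathbb Q$-algebra $R$, all $F,G:W\to R$ and every $\nu\in W$, the linear map $p\otimes q\mapsto q(G)\,p(F)$,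 where $p\mapsto p(F)$ is the algebra map with $a_\omega\mapsto F_\omega$, sends $\Delta(a_\nu)$ to $(G\circledast F)_\nu$. -/

import Mathlib

open CategoryTheory TensorProduct

noncomputable section

namespace Pleth

/-! ## Groupoids, homotopy fibres and homotopy cardinality -/

/-- The set of isomorphism classes of objects (the components of a groupoid). -/
abbrev PiZero (C : Type) [Category.{0} C] : Type := Quotient (isIsomorphicSetoid C)

/-- The isomorphism class of an object. -/
abbrev cls {C : Type} [Category.{0} C] (x : C) : PiZero C :=
  Quotient.mk (isIsomorphicSetoid C) x

/-- The homotopy cardinality `∑ 1 / |Aut x|`, over the isomorphism classes, of a (finite)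
groupoid. -/
def hoCard (C : Type) [Category.{0} C] : ℚ :=
  ∑ᶠ x : PiZero C, 1 / (Nat.card (Aut x.out) : ℚ)

/-- The homotopy fibre of a map of groupoids over `b`: objects are pairs `(a, F a ⟶ b)`. -/
abbrev HoFiber {A B : Type} [Groupoid.{0} A] [Groupoid.{0} B] (F : A ⥤ B) (b : B) : Type :=
  CostructuredArrow F b

instance {A B : Type} [Groupoid.{0} A] [Groupoid.{0} B] (F : A ⥤ B) (b : B) :
    Groupoid.{0} (HoFiber F b) where
  inv f := CostructuredArrow.homMk (Groupoid.inv f.left) (by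
    rw [← CostructuredArrow.w f, ← Category.assoc, ← F.map_comp, Groupoid.inv_comp, F.map_id,
      Category.id_comp])
  inv_comp f := by
    apply CostructuredArrow.hom_ext
    exact Groupoid.inv_comp f.left
  comp_inv f := by
    apply CostructuredArrow.hom_ext
    exact Groupoid.comp_inv f.left

/-- A groupoid is finite if it has finitely many components and finite automorphism groups. -/
def GrpdFinite (C : Type) [Category.{0} C] : Prop :=
  Finite (PiZero C) ∧ ∀ x : C, Finite (Aut x)

/-- A groupoid is locally finite if all automorphism groups are finite. -/
def GrpdLocallyFinite (C : Type) [Category.{0} C] : Prop := ∀ x : C, Finite (Aut x)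

/-- A map of groupoids is finite if all its homotopy fibres are finite. -/
def MapFinite {A B : Type} [Groupoid.{0} A] [Groupoid.{0} B] (F : A ⥤ B) : Prop :=
  ∀ b : B, GrpdFinite (HoFiber F b)

/-- The homotopy cardinality `∑_b |A_b| / |Aut b| δ_b` of a map of groupoids `A ⟶ B`
(with `A` finite), an element of the vector space spanned by the components of `B`. -/
def hoCardMap {A B : Type} [Groupoid.{0} A] [Groupoid.{0} B] (p : A ⥤ B) : PiZero B →₀ ℚ :=
  ∑ᶠ b : PiZero B,
    Finsupp.single b (hoCard (HoFiber p b.out) / (Nat.card (Aut b.out) : ℚ))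

/-! ## Simplicial groupoids with a levelwise monoidal structure -/

/-- A simplicial groupoid, presented by its faces and degeneracies, with a strictly associative
and unital product in every degree that commutes with all faces and degeneracies. -/
structure MonSimplicialGroupoid where
  obj : ℕ → Type
  [grpd : ∀ n, Groupoid.{0} (obj n)]
  d : ∀ {n : ℕ}, Fin (n + 2) → obj (n + 1) ⥤ obj n
  s : ∀ {n : ℕ}, Fin (n + 1) → obj n ⥤ obj (n + 1)
  d_comp_d : ∀ {n : ℕ} (i j : Fin (n + 2)), i ≤ j →
    d j.succ ⋙ d i = d i.castSucc ⋙ d j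
  s_comp_d_of_le : ∀ {n : ℕ} (i : Fin (n + 2)) (j : Fin (n + 1)), i ≤ j.castSucc →
    s j.succ ⋙ d i.castSucc = d i ⋙ s j
  s_comp_d_self : ∀ {n : ℕ} (i : Fin (n + 1)), s i ⋙ d i.castSucc = 𝟭 (obj n)
  s_comp_d_succ : ∀ {n : ℕ} (i : Fin (n + 1)), s i ⋙ d i.succ = 𝟭 (obj n)
  s_comp_d_of_gt : ∀ {n : ℕ} (i : Fin (n + 2)) (j : Fin (n + 1)), j.castSucc < i →
    s j.castSucc ⋙ d i.succ = d i ⋙ s j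
  s_comp_s : ∀ {n : ℕ} (i j : Fin (n + 1)), i ≤ j →
    s j ⋙ s i.castSucc = s i ⋙ s j.succ
  tensor : ∀ n : ℕ, obj n × obj n ⥤ obj n
  unit : ∀ n : ℕ, obj n
  tensor_assoc : ∀ n : ℕ, (tensor n).prod (𝟭 (obj n)) ⋙ tensor n =
    prod.associator (obj n) (obj n) (obj n) ⋙ (𝟭 (obj n)).prod (tensor n) ⋙ tensor n
  unit_tensor : ∀ n : ℕ, Prod.sectR (unit n) (obj n) ⋙ tensor n = 𝟭 (obj n)
  tensor_unit : ∀ n : ℕ, Prod.sectL (obj n) (unit n) ⋙ tensor n = 𝟭 (obj n)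
  tensor_d : ∀ {n : ℕ} (i : Fin (n + 2)), tensor (n + 1) ⋙ d i = (d i).prod (d i) ⋙ tensor n
  tensor_s : ∀ {n : ℕ} (i : Fin (n + 1)), tensor n ⋙ s i = (s i).prod (s i) ⋙ tensor (n + 1)
  d_unit : ∀ {n : ℕ} (i : Fin (n + 2)), (d i).obj (unit (n + 1)) = unit n
  s_unit : ∀ {n : ℕ} (i : Fin (n + 1)), (s i).obj (unit n) = unit (n + 1)

namespace MonSimplicialGroupoid

variable (X : MonSimplicialGroupoid)

instance (n : ℕ) : Groupoid.{0} (X.obj n) := X.grpd n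

/-- Local finiteness: `X₁` is locally finite, and `s₀ : X₀ ⟶ X₁` and `d₁ : X₂ ⟶ X₁` are finite. -/
def LocallyFinite : Prop :=
  GrpdLocallyFinite (X.obj 1) ∧ MapFinite (X.s (n := 0) 0) ∧ MapFinite (X.d (n := 1) 1)

/-- The product on components induced by the product of `X`. -/
instance (n : ℕ) : Monoid (PiZero (X.obj n)) where
  mul := Quotient.map₂ (fun x y => (X.tensor n).obj (x, y))
    (fun _ _ ⟨e⟩ _ _ ⟨e'⟩ => ⟨(X.tensor n).mapIso (e.prod e')⟩)
  one := cls (X.unit n)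
  mul_assoc := by
    rintro ⟨x⟩ ⟨y⟩ ⟨z⟩
    exact congrArg cls (Functor.congr_obj (X.tensor_assoc n) ((x, y), z))
  one_mul := by
    rintro ⟨x⟩
    exact congrArg cls (Functor.congr_obj (X.unit_tensor n) x)
  mul_one := by
    rintro ⟨x⟩
    exact congrArg cls (Functor.congr_obj (X.tensor_unit n) x)

/-- The vector space spanned by the components of `X₁`, with `δ_a δ_b = δ_{a + b}`. -/
abbrev Inc : Type := MonoidAlgebra ℚ (PiZero (X.obj 1))

/-- The basis element `δ_f`. -/
def delta (f : X.obj 1) : X.Inc := MonoidAlgebra.single (cls f) 1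

/-- The cardinality of `(d₂, d₀)_! d₁^* f` in the span of the components of `X₁ × X₁`. -/
def comulCard (f : X.obj 1) : PiZero (X.obj 1 × X.obj 1) →₀ ℚ :=
  hoCardMap (CostructuredArrow.proj (X.d (n := 1) 1) f ⋙
    (X.d (n := 1) 2).prod' (X.d (n := 1) 0))

/-- The identification of the span of the components of `X₁ × X₁` with the tensor square. -/
def toTensor : (PiZero (X.obj 1 × X.obj 1) →₀ ℚ) →ₗ[ℚ] X.Inc ⊗[ℚ] X.Inc :=
  Finsupp.linearCombination ℚ (Quotient.lift
    (fun c : X.obj 1 × X.obj 1 => X.delta c.1 ⊗ₜ[ℚ] X.delta c.2)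
    (by
      rintro ⟨a, b⟩ ⟨a', b'⟩ ⟨e⟩
      have h₁ : cls a = cls a' := Quotient.sound ⟨(CategoryTheory.Prod.fst _ _).mapIso e⟩
      have h₂ : cls b = cls b' := Quotient.sound ⟨(CategoryTheory.Prod.snd _ _).mapIso e⟩
      simp only [delta, h₁, h₂]))

/-- The comultiplication of the homotopy cardinality of the incidence bialgebra:
`δ_f ↦ |(d₂, d₀)_! d₁^* f|`. -/
def comul : X.Inc →ₗ[ℚ] X.Inc ⊗[ℚ] X.Inc :=
  (MonoidAlgebra.basis (PiZero (X.obj 1)) ℚ).constr ℚ fun f => X.toTensor (X.comulCard f.out)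

/-- The counit: `δ_f` is sent to the cardinality of the homotopy fibre of `s₀` over `f`. -/
def counit : X.Inc →ₗ[ℚ] ℚ :=
  (MonoidAlgebra.basis (PiZero (X.obj 1)) ℚ).constr ℚ
    fun f => hoCard (HoFiber (X.s (n := 0) 0) f.out)

end MonSimplicialGroupoid


/-! ## Simplicial monoids as discrete simplicial groupoids -/

/-- A simplicial monoid, presented by its faces and degeneracies. -/
structure SimplicialMonoid where
  obj : ℕ → Type
  [mon : ∀ n, Monoid (obj n)]
  d : ∀ {n : ℕ}, Fin (n + 2) → obj (n + 1) →* obj n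
  s : ∀ {n : ℕ}, Fin (n + 1) → obj n →* obj (n + 1)
  d_comp_d : ∀ {n : ℕ} (i j : Fin (n + 2)), i ≤ j →
    (d i).comp (d j.succ) = (d j).comp (d i.castSucc)
  s_comp_d_of_le : ∀ {n : ℕ} (i : Fin (n + 2)) (j : Fin (n + 1)), i ≤ j.castSucc →
    (d i.castSucc).comp (s j.succ) = (s j).comp (d i)
  s_comp_d_self : ∀ {n : ℕ} (i : Fin (n + 1)), (d i.castSucc).comp (s i) = MonoidHom.id (obj n)
  s_comp_d_succ : ∀ {n : ℕ} (i : Fin (n + 1)), (d i.succ).comp (s i) = MonoidHom.id (obj n)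
  s_comp_d_of_gt : ∀ {n : ℕ} (i : Fin (n + 2)) (j : Fin (n + 1)), j.castSucc < i →
    (d i.succ).comp (s j.castSucc) = (s j).comp (d i)
  s_comp_s : ∀ {n : ℕ} (i j : Fin (n + 1)), i ≤ j →
    (s i.castSucc).comp (s j) = (s j.succ).comp (s i)

/-- Two functors into a discrete groupoid agree if they agree on objects. -/
theorem functor_eq_of_obj {C : Type} [Category.{0} C] {A : Type} {F G : C ⥤ Discrete A}
    (h : ∀ x, F.obj x = G.obj x) : F = G :=
  CategoryTheory.Functor.ext h (fun _ _ _ => Subsingleton.elim _ _)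

namespace SimplicialMonoid

variable (X : SimplicialMonoid)

instance (n : ℕ) : Monoid (X.obj n) := X.mon n

/-- The map of discrete groupoids given by a map of sets. -/
def disc {A B : Type} (f : A → B) : Discrete A ⥤ Discrete B := Discrete.functor (Discrete.mk ∘ f)

/-- The map of discrete groupoids given by a binary operation. -/
def disc₂ {A : Type} (f : A → A → A) : Discrete A × Discrete A ⥤ Discrete A where
  obj p := ⟨f p.1.as p.2.as⟩
  map {p q} g := eqToHom (by rw [Discrete.eq_of_hom g.1, Discrete.eq_of_hom g.2])

/-- A simplicial monoid, as a simplicial groupoid all of whose groupoids are discrete. -/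
def toGrpd : MonSimplicialGroupoid where
  obj n := Discrete (X.obj n)
  d i := disc (X.d i)
  s i := disc (X.s i)
  d_comp_d i j h := functor_eq_of_obj fun x =>
    congrArg Discrete.mk (DFunLike.congr_fun (X.d_comp_d i j h) x.as)
  s_comp_d_of_le i j h := functor_eq_of_obj fun x =>
    congrArg Discrete.mk (DFunLike.congr_fun (X.s_comp_d_of_le i j h) x.as)
  s_comp_d_self i := functor_eq_of_obj fun x =>
    congrArg Discrete.mk (DFunLike.congr_fun (X.s_comp_d_self i) x.as)
  s_comp_d_succ i := functor_eq_of_obj fun x =>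
    congrArg Discrete.mk (DFunLike.congr_fun (X.s_comp_d_succ i) x.as)
  s_comp_d_of_gt i j h := functor_eq_of_obj fun x =>
    congrArg Discrete.mk (DFunLike.congr_fun (X.s_comp_d_of_gt i j h) x.as)
  s_comp_s i j h := functor_eq_of_obj fun x =>
    congrArg Discrete.mk (DFunLike.congr_fun (X.s_comp_s i j h) x.as)
  tensor _ := disc₂ (· * ·)
  unit _ := ⟨1⟩
  tensor_assoc _ := functor_eq_of_obj fun x =>
    congrArg Discrete.mk (mul_assoc x.1.1.as x.1.2.as x.2.as)
  unit_tensor _ := functor_eq_of_obj fun x => congrArg Discrete.mk (one_mul x.as)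
  tensor_unit _ := functor_eq_of_obj fun x => congrArg Discrete.mk (mul_one x.as)
  tensor_d i := functor_eq_of_obj fun x =>
    congrArg Discrete.mk (map_mul (X.d i) x.1.as x.2.as)
  tensor_s i := functor_eq_of_obj fun x =>
    congrArg Discrete.mk (map_mul (X.s i) x.1.as x.2.as)
  d_unit i := congrArg Discrete.mk (map_one (X.d i))
  s_unit i := congrArg Discrete.mk (map_one (X.s i))

end SimplicialMonoid

/-! ## Nonsymmetric operads without nullary operations -/

/-- A coloured nonsymmetric operad in sets without nullary operations: an operad for the free
semigroup monad. `comp ys x _` substitutes the operations `ys` into the inputs of `x`. -/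
structure NSOperad where
  Col : Type
  Op : Type
  src : Op → List Col
  tgt : Op → Col
  src_ne : ∀ x, src x ≠ []
  comp : ∀ (ys : List Op) (x : Op), ys.map tgt = src x → Op
  src_comp : ∀ ys x h, src (comp ys x h) = ys.flatMap src
  tgt_comp : ∀ ys x h, tgt (comp ys x h) = tgt x
  unit : Col → Op
  src_unit : ∀ c, src (unit c) = [c]
  tgt_unit : ∀ c, tgt (unit c) = c
  unit_comp : ∀ (x : Op) (h : ((src x).map unit).map tgt = src x), comp ((src x).map unit) x h = x
  comp_unit : ∀ (x : Op) (h : [x].map tgt = src (unit (tgt x))), comp [x] (unit (tgt x)) h = x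
  assoc : ∀ (ws : List {p : List Op × Op // p.1.map tgt = src p.2}) (x : Op)
    (h₁ : (ws.map fun w => comp w.1.1 w.1.2 w.2).map tgt = src x)
    (h₂ : (ws.map fun w => w.1.2).map tgt = src x)
    (h₃ : (ws.flatMap fun w => w.1.1).map tgt = src (comp (ws.map fun w => w.1.2) x h₂)),
    comp (ws.map fun w => comp w.1.1 w.1.2 w.2) x h₁ =
      comp (ws.flatMap fun w => w.1.1) (comp (ws.map fun w => w.1.2) x h₂) h₃

/-- The reduced associative operad: the terminal operad `M 1 ⟵ M 1 ⟶ 1` for the free semigroup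
monad `M`, with one operation of each positive arity. -/
def Ass : NSOperad where
  Col := Unit
  Op := {l : List Unit // l ≠ []}
  src x := x.1
  tgt _ := ()
  src_ne x := x.2
  comp ys x h := ⟨ys.flatMap Subtype.val, by
    obtain ⟨l, hl⟩ := x
    cases ys with
    | nil => exact absurd h.symm hl
    | cons y ys =>
      intro h0
      exact y.2 (List.append_eq_nil_iff.1 h0).1⟩
  src_comp _ _ _ := rfl
  tgt_comp _ _ _ := rfl
  unit _ := ⟨[()], by simp⟩
  src_unit _ := rfl
  tgt_unit _ := rfl
  unit_comp x h := by
    apply Subtype.ext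
    simp only [List.flatMap_map, List.flatMap_singleton']
  comp_unit x h := by
    apply Subtype.ext
    simp
  assoc ws x h₁ h₂ h₃ := by
    apply Subtype.ext
    simp [List.flatMap_assoc, List.flatMap_map]

namespace NSOperad

/-! ### From operads to categories -/

/-- The objects of the category associated to an operad: its colours. -/
abbrev TCat (Q : NSOperad) : Type := Q.Col

/-- The category associated to an operad: arrows `a ⟶ b` are the operations with output `b` all
of whose inputs are `a`, and the composite of `f` and `g` is `g ∘ (f, …, f)`. -/
instance (Q : NSOperad) : Category.{0} Q.TCat where
  Hom a b := {x : Q.Op // (∀ c ∈ Q.src x, c = a) ∧ Q.tgt x = b}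
  id a := ⟨Q.unit a, by
    constructor
    · intro c hc
      rw [Q.src_unit] at hc
      exact List.mem_singleton.1 hc
    · exact Q.tgt_unit a⟩
  comp {a b c} f g := ⟨Q.comp ((Q.src g.1).map fun _ => f.1) g.1 (by
      rw [List.map_map]
      conv_rhs => rw [← List.map_id (Q.src g.1)]
      exact List.map_congr_left fun e he => f.2.2.trans (g.2.1 e he).symm), by
    constructor
    · intro e he
      rw [Q.src_comp, List.mem_flatMap] at he
      obtain ⟨y, hy, hey⟩ := he
      obtain ⟨_, _, rfl⟩ := List.mem_map.1 hy
      exact f.2.1 e hey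
    · rw [Q.tgt_comp]; exact g.2.2⟩
  id_comp {a b} f := by
    apply Subtype.ext
    have key : ∀ (ys : List Q.Op) (h), ys = (Q.src f.1).map Q.unit → Q.comp ys f.1 h = f.1 := by
      rintro ys h rfl
      exact Q.unit_comp f.1 h
    exact key _ _ (List.map_congr_left fun c hc => by rw [f.2.1 c hc])
  comp_id {a b} f := by
    apply Subtype.ext
    have key : ∀ (ys : List Q.Op) (y : Q.Op) (h), ys = [f.1] → y = Q.unit (Q.tgt f.1) →
        Q.comp ys y h = f.1 := by
      rintro ys y h rfl rfl
      exact Q.comp_unit f.1 h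
    refine key _ _ _ ?_ ?_
    · change (Q.src (Q.unit b)).map _ = _
      rw [Q.src_unit]
      rfl
    · rw [f.2.2]
  assoc {a b c e} f g k := by
    apply Subtype.ext
    have hfg : ((Q.src g.1).map fun _ => f.1).map Q.tgt = Q.src g.1 := by
      rw [List.map_map]
      conv_rhs => rw [← List.map_id (Q.src g.1)]
      exact List.map_congr_left fun e he => f.2.2.trans (g.2.1 e he).symm
    have key : ∀ (l₁ l₂ l₃ : List Q.Op) (h₁ h₂ h₃),
        l₁ = (((Q.src k.1).map fun _ => (⟨((Q.src g.1).map fun _ => f.1, g.1), hfg⟩ :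
          {p : List Q.Op × Q.Op // p.1.map Q.tgt = Q.src p.2})).map
            fun w => Q.comp w.1.1 w.1.2 w.2) →
        l₂ = (((Q.src k.1).map fun _ => (⟨((Q.src g.1).map fun _ => f.1, g.1), hfg⟩ :
          {p : List Q.Op × Q.Op // p.1.map Q.tgt = Q.src p.2})).map fun w => w.1.2) →
        l₃ = (((Q.src k.1).map fun _ => (⟨((Q.src g.1).map fun _ => f.1, g.1), hfg⟩ :
          {p : List Q.Op × Q.Op // p.1.map Q.tgt = Q.src p.2})).flatMap fun w => w.1.1) →
        Q.comp l₁ k.1 h₁ = Q.comp l₃ (Q.comp l₂ k.1 h₂) h₃ := by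
      rintro l₁ l₂ l₃ h₁ h₂ h₃ rfl rfl rfl
      exact Q.assoc _ _ h₁ h₂ h₃
    refine key _ _ _ _ _ _ ?_ ?_ ?_
    · symm
      refine List.map_map.trans ?_
      rfl
    · symm
      refine List.map_map.trans ?_
      rfl
    · change (Q.src (Q.comp _ _ _)).map _ = _
      rw [Q.src_comp, List.flatMap_map, List.flatMap_map, List.map_flatMap]

/-! ### From categories to operads -/

section TOp

variable (C : Type) [Category.{0} C]

/-- The operations of the operad associated to a category: nonempty sequences of arrows with a
common target. -/
abbrev TOps : Type := Σ c : C, {l : List (Σ c' : C, c' ⟶ c) // l ≠ []}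

variable {C}

/-- The sequence of composites `x₁ ∘ y¹₁, …, x₁ ∘ y¹ₙ, …, x_k ∘ yᵏ₁, …`. -/
def graft {c : C} : ∀ (ys : List (TOps C)) (xs : List (Σ c' : C, c' ⟶ c)),
    ys.map Sigma.fst = xs.map Sigma.fst → List (Σ c' : C, c' ⟶ c)
  | [], _, _ => []
  | _ :: _, [], _ => []
  | y :: ys, x :: xs, h =>
    (y.2.1.map fun f => ⟨f.1, f.2 ≫ eqToHom (List.cons.inj h).1 ≫ x.2⟩) ++
      graft ys xs (List.cons.inj h).2


theorem graft_src {c : C} : ∀ (ys : List (TOps C)) (xs : List (Σ c' : C, c' ⟶ c)) (h),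
    (graft ys xs h).map Sigma.fst = ys.flatMap fun y => y.2.1.map Sigma.fst
  | [], _, _ => rfl
  | _ :: _, [], h => absurd h (by simp)
  | y :: ys, x :: xs, h => by
    rw [graft, List.map_append, List.map_map, graft_src ys xs, List.flatMap_cons]
    rfl

theorem graft_ne {c : C} : ∀ (ys : List (TOps C)) (xs : List (Σ c' : C, c' ⟶ c)) (h),
    xs ≠ [] → graft ys xs h ≠ []
  | _, [], _, h' => absurd rfl h'
  | [], _ :: _, h, _ => absurd h (by simp)
  | y :: ys, x :: xs, h, _ => by
    rw [graft]
    intro h0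
    exact y.2.2 (List.map_eq_nil_iff.1 (List.append_eq_nil_iff.1 h0).1)

theorem graft_unit {c : C} : ∀ (ys : List (TOps C)) (xs : List (Σ c' : C, c' ⟶ c)) (h),
    ys = xs.map (fun x => ⟨x.1, [⟨x.1, 𝟙 x.1⟩], by simp⟩) → graft ys xs h = xs
  | [], [], _, _ => rfl
  | [], _ :: _, h, _ => absurd h (by simp)
  | _ :: _, [], h, _ => absurd h (by simp)
  | y :: ys, x :: xs, h, e => by
    rw [List.map_cons] at e
    obtain ⟨rfl, e'⟩ := List.cons.inj e
    rw [graft, graft_unit ys xs _ e']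
    simp

theorem graft_append {c : C} : ∀ (ys ys' : List (TOps C)) (xs xs' : List (Σ c' : C, c' ⟶ c))
    (h : ys.map Sigma.fst = xs.map Sigma.fst) (h' : ys'.map Sigma.fst = xs'.map Sigma.fst) (h''),
    graft (ys ++ ys') (xs ++ xs') h'' = graft ys xs h ++ graft ys' xs' h'
  | [], _, [], _, _, _, _ => rfl
  | [], _, _ :: _, _, h, _, _ => absurd h (by simp)
  | _ :: _, _, [], _, h, _, _ => absurd h (by simp)
  | y :: ys, ys', x :: xs, xs', h, h', h'' => by
    simp only [List.cons_append, graft]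
    rw [graft_append ys ys' xs xs' (List.cons.inj h).2 h', List.append_assoc]

theorem graft_map {c e : C} (g : c ⟶ e) : ∀ (ys : List (TOps C)) (xs : List (Σ c' : C, c' ⟶ c))
    (h : ys.map Sigma.fst = xs.map Sigma.fst) (h'),
    graft ys (xs.map fun x => (⟨x.1, x.2 ≫ g⟩ : Σ c' : C, c' ⟶ e)) h' =
      (graft ys xs h).map fun x => (⟨x.1, x.2 ≫ g⟩ : Σ c' : C, c' ⟶ e)
  | [], _, _, _ => rfl
  | _ :: _, [], h, _ => absurd h (by simp)
  | y :: ys, x :: xs, h, h' => by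
    simp only [List.map_cons, graft]
    rw [graft_map g ys xs (List.cons.inj h).2]
    simp

theorem graft_congr {c : C} {ys ys' : List (TOps C)} {xs xs' : List (Σ c' : C, c' ⟶ c)} (h h')
    (e : ys = ys') (e' : xs = xs') : graft ys xs h = graft ys' xs' h' := by
  subst e e'; rfl

theorem graft_assoc {c : C} :
    ∀ (ws : List {p : List (TOps C) × TOps C // p.1.map Sigma.fst = p.2.2.1.map Sigma.fst})
      (xs : List (Σ c' : C, c' ⟶ c)) (us : List (TOps C)) (h₁ h₂ h₃),
      us = ws.map (fun w => (⟨w.1.2.1, graft w.1.1 w.1.2.2.1 w.2,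
        graft_ne _ _ _ w.1.2.2.2⟩ : TOps C)) →
      graft us xs h₁ =
        graft (ws.flatMap fun w => w.1.1) (graft (ws.map fun w => w.1.2) xs h₂) h₃
  | [], _, _, _, _, _, rfl => rfl
  | _ :: _, [], _, _, h₂, _, _ => absurd h₂ (by simp)
  | w :: ws, x :: xs, _, h₁, h₂, h₃, rfl => by
    have a₁ : (w.1.1.map Sigma.fst : List C) = (w.1.2.2.1.map fun f =>
        (⟨f.1, f.2 ≫ eqToHom (List.cons.inj h₂).1 ≫ x.2⟩ : Σ c' : C, c' ⟶ c)).map Sigma.fst := by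
      rw [w.2, List.map_map]; rfl
    have a₂ : ((ws.flatMap fun w => w.1.1).map Sigma.fst : List C) =
        (graft (ws.map fun w => w.1.2) xs (List.cons.inj h₂).2).map Sigma.fst := by
      rw [graft_src, List.flatMap_map, List.map_flatMap]
      simp only [fun w : {p : List (TOps C) × TOps C //
        p.1.map Sigma.fst = p.2.2.1.map Sigma.fst} => w.2]
    have a₃ := graft_append w.1.1 (ws.flatMap fun w => w.1.1) _ _ a₁ a₂
      (by rw [List.map_append, List.map_append, a₁, a₂])
    refine Eq.trans ?_ a₃.symm
    rw [graft_map _ _ _ w.2, ← graft_assoc ws xs _ (List.cons.inj h₁).2 _ _ rfl]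
    rfl

end TOp

/-- The operad associated to a category: its operations are the nonempty sequences of arrows with
a common target, the inputs are the sources, and the output is the common target. -/
def TOperad (C : Type) [Category.{0} C] : NSOperad where
  Col := C
  Op := TOps C
  src x := x.2.1.map Sigma.fst
  tgt x := x.1
  src_ne x h := x.2.2 (List.map_eq_nil_iff.1 h)
  comp ys x h := ⟨x.1, graft ys x.2.1 h, graft_ne ys x.2.1 h x.2.2⟩
  src_comp ys x h := graft_src ys x.2.1 h
  tgt_comp _ _ _ := rfl
  unit c := ⟨c, [⟨c, 𝟙 c⟩], by simp⟩
  src_unit _ := rfl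
  tgt_unit _ := rfl
  unit_comp x h := by
    obtain ⟨c, l, hl⟩ := x
    have := graft_unit _ l h (by rw [List.map_map]; rfl)
    simp only [this]
  comp_unit x h := by
    obtain ⟨c, l, hl⟩ := x
    simp [graft]
  assoc ws x h₁ h₂ h₃ := by
    have := graft_assoc ws x.2.1 _ h₁ h₂ h₃ rfl
    simp only [this]

/-- The operad obtained from an operad by passing to its category and back. -/
abbrev TT (Q : NSOperad) : NSOperad := TOperad Q.TCat

end NSOperad

/-! ## The two-sided bar construction -/

namespace NSOperad

section Bar

variable (Q : NSOperad)

/-- The value `M X ×_{M Q₀} Q₁` on `f : X ⟶ Q₀` of the monad on sets over `Q₀` defined by `Q`: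
an operation of `Q` with an element of `X` attached to every input. -/
abbrev Attach {X : Type} (f : X → Q.Col) : Type := {p : List X × Q.Op // p.1.map f = Q.src p.2}

variable {Q}

/-- The structure map to `Q₀`: the output of the operation. -/
def Attach.root {X : Type} {f : X → Q.Col} (t : Q.Attach f) : Q.Col := Q.tgt t.1.2

/-- The monad defined by `Q`, on maps over `Q₀`. -/
def Attach.map {X Y : Type} {f : X → Q.Col} {g : Y → Q.Col} (h : X → Y) (hh : ∀ x, g (h x) = f x)
    (t : Q.Attach f) : Q.Attach g :=
  ⟨(t.1.1.map h, t.1.2), by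
    rw [← t.2, List.map_map]
    exact List.map_congr_left fun x _ => hh x⟩

/-- The multiplication of the monad defined by `Q`. -/
def Attach.mu {X : Type} {f : X → Q.Col}
    (t : Q.Attach (Attach.root : Q.Attach f → Q.Col)) : Q.Attach f :=
  ⟨(t.1.1.flatMap fun y => y.1.1, Q.comp (t.1.1.map fun y => y.1.2) t.1.2
      (by rw [List.map_map]; exact t.2)), by
    rw [Q.src_comp, List.flatMap_map, List.map_flatMap]
    simp only [fun y : Q.Attach f => y.2]⟩

/-- The unit of the monad defined by `Q`. -/
def Attach.eta {X : Type} {f : X → Q.Col} (x : X) : Q.Attach f :=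
  ⟨([x], Q.unit (f x)), (Q.src_unit (f x)).symm⟩

theorem comp_congr {ys ys' : List Q.Op} {x x' : Q.Op} (h h') (e : ys = ys') (e' : x = x') :
    Q.comp ys x h = Q.comp ys' x' h' := by
  subst e e'; rfl

theorem Attach.map_mu {X Y : Type} {f : X → Q.Col} {g : Y → Q.Col} (h : X → Y)
    (hh : ∀ x, g (h x) = f x) (t : Q.Attach (Attach.root : Q.Attach f → Q.Col)) (h') :
    Attach.map (f := f) (g := g) h hh (Attach.mu t) =
      Attach.mu (Attach.map (g := Attach.root) (Attach.map h hh) h' t) := by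
  apply Subtype.ext
  refine Prod.ext ?_ ?_
  · simp [Attach.map, Attach.mu, List.map_flatMap, List.flatMap_map]
  · refine comp_congr _ _ ?_ rfl
    simp [Attach.map]

theorem Attach.mu_mu {X : Type} {f : X → Q.Col}
    (t : Q.Attach (Attach.root : Q.Attach (Attach.root : Q.Attach f → Q.Col) → Q.Col)) (h) :
    Attach.mu (Attach.mu t) = Attach.mu (Attach.map Attach.mu h t) := by
  apply Subtype.ext
  refine Prod.ext ?_ ?_
  · simp [Attach.map, Attach.mu, List.flatMap_map, List.flatMap_assoc]
  · have key := Q.assoc (t.1.1.map fun y => (⟨(y.1.1.map fun z => z.1.2, y.1.2), by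
        rw [List.map_map]; exact y.2⟩ : {p : List Q.Op × Q.Op // p.1.map Q.tgt = Q.src p.2}))
      t.1.2 (by
        rw [List.map_map, List.map_map, ← t.2]
        exact List.map_congr_left fun y _ => Q.tgt_comp _ _ _) (by
        rw [List.map_map, List.map_map]
        exact t.2) (by
        rw [Q.src_comp, List.flatMap_map, List.map_flatMap, List.map_map, List.flatMap_map]
        refine congrArg (fun k => List.flatMap k t.1.1) (funext fun y => ?_)
        rw [List.map_map]
        exact y.2)
    refine Eq.trans (comp_congr _ _ ?_ ?_) (key.symm.trans (comp_congr _ _ ?_ rfl))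
    · simp [Attach.mu, List.map_flatMap, List.flatMap_map]
    · refine comp_congr _ _ ?_ rfl
      rw [List.map_map]; rfl
    · simp [Attach.mu, Attach.map]

theorem Attach.mu_eta {X : Type} {f : X → Q.Col} (t : Q.Attach f) :
    Attach.mu (Attach.eta t) = t := by
  apply Subtype.ext
  refine Prod.ext ?_ ?_
  · simp [Attach.mu, Attach.eta]
  · exact Q.comp_unit t.1.2 _

theorem Attach.mu_map_eta {X : Type} {f : X → Q.Col} (t : Q.Attach f) (h) :
    Attach.mu (Attach.map (g := (Attach.root : Q.Attach f → Q.Col)) Attach.eta h t) = t := by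
  apply Subtype.ext
  refine Prod.ext ?_ ?_
  · simp [Attach.mu, Attach.map, Attach.eta, List.flatMap_map]
  · have key := Q.unit_comp t.1.2 (by
      rw [List.map_map]
      conv_rhs => rw [← List.map_id (Q.src t.1.2)]
      exact List.map_congr_left fun c _ => Q.tgt_unit c)
    refine Eq.trans (comp_congr _ _ ?_ rfl) key
    rw [← t.2]
    simp [Attach.map, Attach.eta]

theorem Attach.map_map {X Y Z : Type} {f : X → Q.Col} {g : Y → Q.Col} {k : Z → Q.Col} (h : X → Y)
    (hh : ∀ x, g (h x) = f x) (h' : Y → Z) (hh' : ∀ y, k (h' y) = g y) (t : Q.Attach f) :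
    Attach.map (g := k) h' hh' (Attach.map (g := g) h hh t) =
      Attach.map (g := k) (fun x => h' (h x)) (fun x => (hh' _).trans (hh x)) t := by
  apply Subtype.ext
  refine Prod.ext ?_ rfl
  simp [Attach.map]

theorem Attach.map_congr {X Y : Type} {f : X → Q.Col} {g : Y → Q.Col} {h k : X → Y}
    (hh : ∀ x, g (h x) = f x) (hk : ∀ x, g (k x) = f x) (e : ∀ x, h x = k x) (t : Q.Attach f) :
    Attach.map h hh t = Attach.map k hk t := by
  obtain rfl : h = k := funext e
  rfl

theorem Attach.map_id {X : Type} {f : X → Q.Col} {h : X → X} (hh : ∀ x, f (h x) = f x)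
    (e : ∀ x, h x = x) (t : Q.Attach f) : Attach.map h hh t = t := by
  obtain rfl : h = id := funext e
  apply Subtype.ext
  refine Prod.ext ?_ rfl
  simp [Attach.map]

theorem Attach.map_square {X Y Y' Z : Type} {f : X → Q.Col} {g : Y → Q.Col} {g' : Y' → Q.Col}
    {k : Z → Q.Col} (p : {h : X → Y // ∀ x, g (h x) = f x}) (q : {h : Y → Z // ∀ x, k (h x) = g x})
    (p' : {h : X → Y' // ∀ x, g' (h x) = f x}) (q' : {h : Y' → Z // ∀ x, k (h x) = g' x})
    (e : ∀ x, q.1 (p.1 x) = q'.1 (p'.1 x))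
    {P : {h : Q.Attach f → Q.Attach g // ∀ t, (h t).root = t.root}}
    {R : {h : Q.Attach g → Q.Attach k // ∀ t, (h t).root = t.root}}
    {P' : {h : Q.Attach f → Q.Attach g' // ∀ t, (h t).root = t.root}}
    {R' : {h : Q.Attach g' → Q.Attach k // ∀ t, (h t).root = t.root}}
    (hP : P = ⟨Attach.map p.1 p.2, fun _ => rfl⟩) (hR : R = ⟨Attach.map q.1 q.2, fun _ => rfl⟩)
    (hP' : P' = ⟨Attach.map p'.1 p'.2, fun _ => rfl⟩)
    (hR' : R' = ⟨Attach.map q'.1 q'.2, fun _ => rfl⟩) (t : Q.Attach f) :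
    R.1 (P.1 t) = R'.1 (P'.1 t) := by
  subst hP hR hP' hR'
  change Attach.map q.1 q.2 (Attach.map p.1 p.2 t) = Attach.map q'.1 q'.2 (Attach.map p'.1 p'.2 t)
  rw [Attach.map_map, Attach.map_map]
  exact Attach.map_congr _ _ e t

theorem Attach.map_eta {X Y : Type} {f : X → Q.Col} {g : Y → Q.Col} (h : X → Y)
    (hh : ∀ x, g (h x) = f x) (x : X) :
    Attach.map h hh (Attach.eta x : Q.Attach f) = (Attach.eta (h x) : Q.Attach g) := by
  apply Subtype.ext
  refine Prod.ext rfl ?_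
  simp [Attach.map, Attach.eta, hh]

variable (Q)

/-- The iterates on the terminal object `Q₀ ⟶ Q₀` of the monad defined by `Q`. -/
def treeAux : ℕ → Σ T : Type, T → Q.Col
  | 0 => ⟨Q.Col, id⟩
  | n + 1 => ⟨Q.Attach (treeAux n).2, Attach.root⟩

/-- The trees of height `n` of operations of `Q`; thus `Tree 0` is `Q₀`, `Tree 1` is
`M Q₀ ×_{M Q₀} Q₁ = Q₁`, and `Tree 2` is `M Q₁ ×_{M Q₀} Q₁`. -/
abbrev Tree (n : ℕ) : Type := (Q.treeAux n).1

/-- The output colour of a tree. -/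
abbrev root (n : ℕ) : Q.Tree n → Q.Col := (Q.treeAux n).2

/-- The faces of trees other than the top face: the `0`th one removes the operations furthest from
the root (keeping their outputs), the others compose two adjacent levels. -/
def face : ∀ n : ℕ, ℕ → {g : Q.Tree (n + 1) → Q.Tree n // ∀ t, Q.root n (g t) = Q.root (n + 1) t}
  | 0, _ => ⟨fun t => Q.tgt t.1.2, fun _ => rfl⟩
  | n + 1, i =>
    if i ≤ n then
      ⟨Attach.map (f := Q.root (n + 1)) (g := Q.root n) (face n i).1 (face n i).2, fun _ => rfl⟩
    else ⟨Attach.mu (f := Q.root n), fun _ => Q.tgt_comp _ _ _⟩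

/-- The degeneracies of trees: insertion of a level of units. -/
def degen : ∀ n : ℕ, ℕ → {g : Q.Tree n → Q.Tree (n + 1) // ∀ t, Q.root (n + 1) (g t) = Q.root n t}
  | 0, _ => ⟨Attach.eta (f := Q.root 0), fun _ => Q.tgt_unit _⟩
  | n + 1, i =>
    if i ≤ n then
      ⟨Attach.map (f := Q.root n) (g := Q.root (n + 1)) (degen n i).1 (degen n i).2, fun _ => rfl⟩
    else ⟨Attach.eta (f := Q.root (n + 1)), fun _ => Q.tgt_unit _⟩

theorem face_le {n i : ℕ} (h : i ≤ n) : Q.face (n + 1) i =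
    ⟨Attach.map (f := Q.root (n + 1)) (g := Q.root n) (Q.face n i).1 (Q.face n i).2,
      fun _ => rfl⟩ := by
  rw [face, if_pos h]

theorem face_last (n : ℕ) : Q.face (n + 1) (n + 1) =
    ⟨Attach.mu (f := Q.root n), fun _ => Q.tgt_comp _ _ _⟩ := by
  rw [face, if_neg (by omega)]

theorem degen_le {n i : ℕ} (h : i ≤ n) : Q.degen (n + 1) i =
    ⟨Attach.map (f := Q.root n) (g := Q.root (n + 1)) (Q.degen n i).1 (Q.degen n i).2,
      fun _ => rfl⟩ := by
  rw [degen, if_pos h]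

theorem degen_last (n : ℕ) : Q.degen n n =
    ⟨Attach.eta (f := Q.root n), fun _ => Q.tgt_unit _⟩ := by
  cases n with
  | zero => rfl
  | succ n => rw [degen, if_neg (by omega)]

theorem face_face : ∀ (n i j : ℕ), i ≤ j → j ≤ n → ∀ t : Q.Tree (n + 2),
    (Q.face n i).1 ((Q.face (n + 1) (j + 1)).1 t) = (Q.face n j).1 ((Q.face (n + 1) i).1 t)
  | 0, i, j, hij, hj, t => by
    obtain rfl : j = 0 := by omega
    obtain rfl : i = 0 := by omega
    rw [Q.face_last 0, Q.face_le le_rfl]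
    exact Q.tgt_comp _ _ _
  | n + 1, i, j, hij, hj, t => by
    rcases Nat.lt_or_ge n j with hj' | hj'
    · obtain rfl : j = n + 1 := by omega
      rw [Q.face_le (n := n + 1) (i := i) (by omega), Q.face_last (n + 1), Q.face_last n]
      rcases Nat.lt_or_ge n i with hi | hi
      · obtain rfl : i = n + 1 := by omega
        rw [Q.face_last n]
        exact Attach.mu_mu (f := Q.root n) t (fun y => Q.tgt_comp _ _ _)
      · rw [Q.face_le hi]
        exact Attach.map_mu (f := Q.root (n + 1)) (g := Q.root n) (Q.face n i).1 (Q.face n i).2 t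
          (fun _ => rfl)
    · exact Attach.map_square (Q.face (n + 1) (j + 1)) (Q.face n i) (Q.face (n + 1) i) (Q.face n j)
        (fun x => face_face n i j hij hj' x) (Q.face_le (by omega)) (Q.face_le (by omega)) (Q.face_le (by omega)) (Q.face_le (by omega)) t

theorem face_degen_le : ∀ (n i j : ℕ), i ≤ j → j ≤ n → ∀ t : Q.Tree (n + 1),
    (Q.face (n + 1) i).1 ((Q.degen (n + 1) (j + 1)).1 t) = (Q.degen n j).1 ((Q.face n i).1 t)
  | 0, i, j, hij, hj, t => by
    obtain rfl : j = 0 := by omega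
    obtain rfl : i = 0 := by omega
    rw [Q.degen_last 1, Q.face_le le_rfl]
    exact Attach.map_eta (f := Q.root 1) (g := Q.root 0) (Q.face 0 0).1 (Q.face 0 0).2 t
  | n + 1, i, j, hij, hj, t => by
    rcases Nat.lt_or_ge n j with hj' | hj'
    · obtain rfl : j = n + 1 := by omega
      rw [Q.face_le (n := n + 1) (i := i) (by omega), Q.degen_last (n + 2), Q.degen_last (n + 1)]
      exact Attach.map_eta (f := Q.root (n + 2)) (g := Q.root (n + 1)) (Q.face (n + 1) i).1
        (Q.face (n + 1) i).2 t
    · exact Attach.map_square (Q.degen (n + 1) (j + 1)) (Q.face (n + 1) i) (Q.face n i) (Q.degen n j)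
        (fun x => face_degen_le n i j hij hj' x) (Q.degen_le (by omega)) (Q.face_le (by omega)) (Q.face_le (by omega)) (Q.degen_le (by omega)) t

theorem face_degen_self : ∀ (n i : ℕ), i ≤ n → ∀ t : Q.Tree n,
    (Q.face n i).1 ((Q.degen n i).1 t) = t
  | 0, i, hi, t => Q.tgt_unit _
  | n + 1, i, hi, t => by
    rcases Nat.lt_or_ge n i with hi' | hi'
    · obtain rfl : i = n + 1 := by omega
      rw [Q.degen_last (n + 1), Q.face_last n]
      exact Attach.mu_eta t
    · rw [Q.degen_le hi', Q.face_le hi']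
      refine (Attach.map_map _ (Q.degen n i).2 _ (Q.face n i).2 t).trans ?_
      exact Attach.map_id _ (fun x => face_degen_self n i hi' x) t

theorem face_degen_succ : ∀ (n i : ℕ), i < n → ∀ t : Q.Tree n,
    (Q.face n (i + 1)).1 ((Q.degen n i).1 t) = t
  | 0, i, hi, t => absurd hi (by omega)
  | n + 1, i, hi, t => by
    rw [Q.degen_le (by omega)]
    rcases Nat.lt_or_ge i n with hi' | hi'
    · rw [Q.face_le (by omega)]
      refine (Attach.map_map _ (Q.degen n i).2 _ (Q.face n (i + 1)).2 t).trans ?_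
      exact Attach.map_id _ (fun x => face_degen_succ n i hi' x) t
    · obtain rfl : i = n := by omega
      rw [Q.face_last i]
      refine Eq.trans ?_ (Attach.mu_map_eta (f := Q.root i) t (fun x => Q.tgt_unit _))
      exact congrArg (Attach.mu (f := Q.root i))
        (Attach.map_congr (Q.degen i i).2 _ (fun x => congrFun (congrArg Subtype.val (Q.degen_last i)) x) t)

theorem face_degen_gt : ∀ (n i j : ℕ), j < i → i ≤ n → ∀ t : Q.Tree (n + 1),
    (Q.face (n + 1) (i + 1)).1 ((Q.degen (n + 1) j).1 t) = (Q.degen n j).1 ((Q.face n i).1 t)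
  | 0, i, j, hij, hj, t => absurd hij (by omega)
  | n + 1, i, j, hij, hj, t => by
    rcases Nat.lt_or_ge n i with hi' | hi'
    · obtain rfl : i = n + 1 := by omega
      rw [Q.degen_le (n := n + 1) (i := j) (by omega), Q.degen_le (n := n) (i := j) (by omega),
        Q.face_last (n + 1), Q.face_last n]
      exact (Attach.map_mu (f := Q.root n) (g := Q.root (n + 1)) (Q.degen n j).1
        (Q.degen n j).2 t (fun _ => rfl)).symm
    · exact Attach.map_square (Q.degen (n + 1) j) (Q.face (n + 1) (i + 1)) (Q.face n i) (Q.degen n j)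
        (fun x => face_degen_gt n i j hij hi' x) (Q.degen_le (by omega)) (Q.face_le (by omega)) (Q.face_le (by omega)) (Q.degen_le (by omega)) t

theorem degen_degen : ∀ (n i j : ℕ), i ≤ j → j ≤ n → ∀ t : Q.Tree n,
    (Q.degen (n + 1) i).1 ((Q.degen n j).1 t) = (Q.degen (n + 1) (j + 1)).1 ((Q.degen n i).1 t)
  | 0, i, j, hij, hj, t => by
    obtain rfl : j = 0 := by omega
    obtain rfl : i = 0 := by omega
    rw [Q.degen_last 1, Q.degen_le le_rfl, Q.degen_last 0]
    exact Attach.map_eta (f := Q.root 0) (g := Q.root 1) Attach.eta (fun _ => Q.tgt_unit _) t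
  | n + 1, i, j, hij, hj, t => by
    rcases Nat.lt_or_ge n j with hj' | hj'
    · obtain rfl : j = n + 1 := by omega
      rw [Q.degen_le (n := n + 1) (i := i) (by omega), Q.degen_last (n + 2), Q.degen_last (n + 1)]
      exact Attach.map_eta (f := Q.root (n + 1)) (g := Q.root (n + 2)) (Q.degen (n + 1) i).1
        (Q.degen (n + 1) i).2 t
    · exact Attach.map_square (Q.degen n j) (Q.degen (n + 1) i) (Q.degen n i) (Q.degen (n + 1) (j + 1))
        (fun x => degen_degen n i j hij hj' x) (Q.degen_le (by omega)) (Q.degen_le (by omega)) (Q.degen_le (by omega)) (Q.degen_le (by omega)) t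

/-- The faces of the bar construction. The top face sends a tree to the forest left when the
operation at the root is removed; the other faces are applied to each tree of a forest. -/
def barFace (n i : ℕ) : FreeMonoid (Q.Tree (n + 1)) →* FreeMonoid (Q.Tree n) :=
  if i ≤ n then FreeMonoid.map (Q.face n i).1
  else FreeMonoid.lift fun t => FreeMonoid.ofList t.1.1

theorem barFace_le {n i : ℕ} (h : i ≤ n) (t : Q.Tree (n + 1)) :
    Q.barFace n i (FreeMonoid.of t) = FreeMonoid.of ((Q.face n i).1 t) := by
  rw [barFace, if_pos h, FreeMonoid.map_of]

theorem barFace_last (n : ℕ) (t : Q.Tree (n + 1)) :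
    Q.barFace n (n + 1) (FreeMonoid.of t) = FreeMonoid.ofList t.1.1 := by
  rw [barFace, if_neg (by omega), FreeMonoid.lift_eval_of]

theorem barFace_ofList_le {n i : ℕ} (h : i ≤ n) (l : List (Q.Tree (n + 1))) :
    Q.barFace n i (FreeMonoid.ofList l) = FreeMonoid.ofList (l.map (Q.face n i).1) := by
  rw [barFace, if_pos h]
  rfl

theorem barFace_ofList_last (n : ℕ) (l : List (Q.Tree (n + 1))) :
    Q.barFace n (n + 1) (FreeMonoid.ofList l) =
      FreeMonoid.ofList (l.flatMap fun t : Q.Tree (n + 1) => t.1.1) := by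
  rw [barFace, if_neg (by omega)]
  induction l with
  | nil => rfl
  | cons t l ih =>
    rw [FreeMonoid.ofList_cons, map_mul, ih, FreeMonoid.lift_eval_of, List.flatMap_cons,
      FreeMonoid.ofList_append]

/-- The two-sided bar construction of an operad, over the free monoid monad: in degree `n` it is
the free monoid on the trees of height `n`, that is, the set of forests of height `n`. -/
def bar : SimplicialMonoid where
  obj n := FreeMonoid (Q.Tree n)
  d {n} i := Q.barFace n i.1
  s {n} i := FreeMonoid.map (Q.degen n i.1).1
  d_comp_d {n} i j h := by
    refine FreeMonoid.hom_eq fun t => ?_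
    have h' : i.1 ≤ j.1 := h
    have hj := j.2
    simp only [MonoidHom.comp_apply, Fin.val_succ, Fin.val_castSucc]
    rcases Nat.lt_or_ge n j.1 with hj' | hj'
    · have ej : j.1 = n + 1 := by omega
      rw [ej, barFace_last]
      rcases Nat.lt_or_ge n i.1 with hi | hi
      · have ei : i.1 = n + 1 := by omega
        rw [ei, barFace_le _ le_rfl, barFace_ofList_last, barFace_last, Q.face_last]
        rfl
      · rw [barFace_le _ (by omega), barFace_ofList_le _ hi, barFace_last, Q.face_le hi]
        rfl
    · rw [barFace_le _ (by omega), barFace_le _ (by omega), barFace_le _ (by omega),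
        barFace_le _ (by omega), Q.face_face n _ _ h' hj']
  s_comp_d_of_le {n} i j h := by
    refine FreeMonoid.hom_eq fun t => ?_
    have h' : i.1 ≤ j.1 := h
    have hj := j.2
    simp only [MonoidHom.comp_apply, Fin.val_succ, Fin.val_castSucc, FreeMonoid.map_of]
    rw [barFace_le _ (by omega), barFace_le _ (by omega), FreeMonoid.map_of,
      Q.face_degen_le n _ _ h' (by omega)]
  s_comp_d_self {n} i := by
    refine FreeMonoid.hom_eq fun t => ?_
    have hi := i.2
    simp only [MonoidHom.comp_apply, Fin.val_castSucc, FreeMonoid.map_of]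
    rw [barFace_le _ (by omega), Q.face_degen_self n _ (by omega)]
    rfl
  s_comp_d_succ {n} i := by
    refine FreeMonoid.hom_eq fun t => ?_
    have hi := i.2
    simp only [MonoidHom.comp_apply, Fin.val_succ, FreeMonoid.map_of]
    rcases Nat.lt_or_ge i.1 n with hi' | hi'
    · rw [barFace_le _ (by omega), Q.face_degen_succ n _ hi']
      rfl
    · have ei : i.1 = n := by omega
      rw [ei, barFace_last, Q.degen_last]
      rfl
  s_comp_d_of_gt {n} i j h := by
    refine FreeMonoid.hom_eq fun t => ?_
    have h' : j.1 < i.1 := h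
    have hi := i.2
    simp only [MonoidHom.comp_apply, Fin.val_succ, Fin.val_castSucc, FreeMonoid.map_of]
    rcases Nat.lt_or_ge n i.1 with hi' | hi'
    · have ei : i.1 = n + 1 := by omega
      rw [ei, barFace_last, barFace_last, Q.degen_le (by omega)]
      rfl
    · rw [barFace_le _ (by omega), barFace_le _ (by omega), FreeMonoid.map_of,
        Q.face_degen_gt n _ _ h' hi']
  s_comp_s {n} i j h := by
    refine FreeMonoid.hom_eq fun t => ?_
    have h' : i.1 ≤ j.1 := h
    have hj := j.2
    simp only [MonoidHom.comp_apply, Fin.val_succ, Fin.val_castSucc, FreeMonoid.map_of]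
    rw [Q.degen_degen n _ _ h' (by omega)]

end Bar

end NSOperad

/-! ## The bar construction of the operad of sequences of elements of `Ass` -/

/-- The two-sided bar construction of `TT Ass`, a discrete simplicial groupoid. -/
def barTTAss : MonSimplicialGroupoid := (NSOperad.TT Ass).bar.toGrpd

/-- The nonempty finite words of positive natural numbers. -/
abbrev Word : Type := {w : List ℕ+ // w ≠ []}

/-- The operation of arity `n` of `Ass`. -/
def assOp (n : ℕ+) : Ass.Op :=
  ⟨List.replicate n (), fun h => n.ne_zero ((List.replicate_eq_nil_iff ()).1 h)⟩

/-- The unique object of the category associated to `Ass`. -/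
def assObj : Ass.TCat := ()

/-- The operation of arity `n` of `Ass`, as an arrow of the category associated to `Ass`. -/
def assArrow (n : ℕ+) : Σ c : Ass.TCat, c ⟶ assObj :=
  ⟨assObj, ⟨assOp n, fun _ _ => rfl, rfl⟩⟩

/-- A word `ω₁ … ωₙ` as an operation of `TT Ass`: the sequence of the operations of `Ass` of
arities `ω₁, …, ωₙ`. -/
def wordOp (w : Word) : (NSOperad.TT Ass).Op :=
  ⟨assObj, w.1.map assArrow, fun h => w.2 (List.map_eq_nil_iff.1 h)⟩

/-- The connected object of degree `1` of the bar construction given by a word: the sequence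
consisting of one operation. -/
def connected (w : Word) : barTTAss.obj 1 :=
  ⟨FreeMonoid.of ⟨((NSOperad.TT Ass).src (wordOp w), wordOp w), List.map_id _⟩⟩

/-! ## Power series in noncommuting variables and plethystic substitution -/

section Series

variable {R : Type*} [Ring R]

/-- The `k`th Verschiebung operator on words, `k ω₁ … ωₙ = (k ω₁) … (k ωₙ)`. -/
def versch (k : ℕ+) (w : Word) : Word :=
  ⟨w.1.map (k * ·), fun h => w.2 (List.map_eq_nil_iff.1 h)⟩

/-- The coefficients of the power series `F_k = F(x_k, x_{2k}, …)`, where `F` is the power series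
`∑ F_w x_w` without constant term in the noncommuting variables `x₁, x₂, …`. -/
def dilate (k : ℕ+) (F : Word → R) (w : List ℕ+) : R :=
  ∑ᶠ (v : Word) (_ : (versch k v).1 = w), F v

/-- The product of power series in noncommuting variables. -/
def seriesMul (F G : List ℕ+ → R) (w : List ℕ+) : R :=
  ∑ i ∈ Finset.range (w.length + 1), F (w.take i) * G (w.drop i)

/-- The product, in order, of a list of power series in noncommuting variables. -/
def seriesProd (l : List (List ℕ+ → R)) : List ℕ+ → R :=
  l.foldr seriesMul fun w => if w = [] then 1 else 0

/-- The plethystic substitution `G ⊛ F = G(F₁, F₂, …) = ∑ G_ω F_{ω₁} ⋯ F_{ωₙ}` of power series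
without constant term in noncommuting variables, with coefficients in a ring `R`. -/
def subst (G F : Word → R) (ν : Word) : R :=
  ∑ᶠ ω : Word, G ω * seriesProd (ω.1.map fun k => dilate k F) ν.1

end Series

/-! ## The noncommutative linear plethystic bialgebra with noncommuting variables -/

/-- The free associative unital algebra on the symbols `a_ω`. -/
abbrev PLin : Type := FreeAlgebra ℚ Word

namespace PLin

/-- The generator `a_ω`. -/
def a (w : Word) : PLin := FreeAlgebra.ι ℚ w

/-- The comultiplication induced by plethystic substitution: `Δ(a_ν)` is the coefficient of `ν` in
`G ⊛ F`, for the generic series `F = ∑ (a_ω ⊗ 1) x_ω` and `G = ∑ (1 ⊗ a_ω) x_ω`. -/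
def comul : PLin →ₐ[ℚ] PLin ⊗[ℚ] PLin :=
  FreeAlgebra.lift ℚ fun ν =>
    subst (R := PLin ⊗[ℚ] PLin) (fun w => 1 ⊗ₜ[ℚ] a w) (fun w => a w ⊗ₜ[ℚ] 1) ν

/-- The series `x₁`, the neutral element of plethystic substitution. -/
def seriesX : Word → ℚ := fun w => if w.1 = [1] then 1 else 0

/-- The counit: `a_ν` is sent to the coefficient of `ν` in `x₁`. -/
def counit : PLin →ₐ[ℚ] ℚ := FreeAlgebra.lift ℚ seriesX

end PLin

/-- The evaluation of an element of the free algebra on the symbols `a_ω` at a power series with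
coefficients in a `ℚ`-algebra: `a_ω` is sent to the coefficient of `ω`. -/
def evalSeries {R : Type*} [Ring R] [Algebra ℚ R] (F : Word → R) : PLin →ₐ[ℚ] R :=
  FreeAlgebra.lift ℚ F

/-- The evaluation of a tensor `p ⊗ q` at the pair of power series `(F, G)`, with the coefficient
of the outer series `G` put on the left of those of `F`. -/
def evalPair {R : Type*} [Ring R] [Algebra ℚ R] (F G : Word → R) : PLin ⊗[ℚ] PLin →ₗ[ℚ] R :=
  TensorProduct.lift
    ((LinearMap.mul ℚ R).flip.compl₁₂ (evalSeries F).toLinearMap (evalSeries G).toLinearMap)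

/-- A linear comultiplication and a linear counit on an algebra are a bialgebra structure. -/
structure IsBialgebra (A : Type) [Ring A] [Algebra ℚ A] (Δ : A →ₗ[ℚ] A ⊗[ℚ] A)
    (ε : A →ₗ[ℚ] ℚ) : Prop where
  coassoc : TensorProduct.assoc ℚ A A A ∘ₗ Δ.rTensor A ∘ₗ Δ = Δ.lTensor A ∘ₗ Δ
  rTensor_counit : ε.rTensor A ∘ₗ Δ = TensorProduct.mk ℚ ℚ A 1
  lTensor_counit : ε.lTensor A ∘ₗ Δ = (TensorProduct.mk ℚ A ℚ).flip 1
  comul_one : Δ 1 = 1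
  comul_mul : ∀ x y, Δ (x * y) = Δ x * Δ y
  counit_one : ε 1 = 1
  counit_mul : ∀ x y, ε (x * y) = ε x * ε y

/-- The set of pairs `(ω, κ)`, with `κ` a sequence of `|ω|` words, such that `ν` is the
concatenation `ω₁ κ₁ + ⋯ + ωₙ κₙ`. -/
def decompositions (ν : Word) : Set (Word × List Word) :=
  {p | p.2.length = p.1.1.length ∧
    (List.zipWith (fun k w => (versch k w).1) p.1.1 p.2).flatten = ν.1}

end Pleth

end

/-! The bar construction is discrete, so homotopy cardinality is counting: the coproduct of `δ_f` is
the sum of `δ_{d₂ t} ⊗ δ_{d₀ t}` over the elements `t` of degree 2 with `d₁ t = f`, and the counit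
counts the preimages of `f` under `s₀`. Everything rests on describing degrees 1 and 2.

A tree of height 1 is an operation, that is, a word. A tree of height 2 is a root word `ω` with a
word `κᵢ` attached to its `i`th input, that is, a nonempty list of pairs `(ωᵢ, κᵢ)`; this is the
type `Dec`. Composing operations of `Ass` of which all inner ones are equal multiplies arities, so
`d₁` gives the concatenation of the `ωᵢ κᵢ` (`mu_decTree`), while `d₀` gives `ω` and `d₂` gives the
sequence `κ`.

On the side of power series, the coefficient of `ν` in `F_{ω₁} ⋯ F_{ωₙ}` sums over the ways to cut
`ν` into consecutive pieces `ωᵢ κᵢ`. Hence the coefficient of `ν` in `G ⊛ F` is a sum over the same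
lists of pairs (`subst_eq_sum`), finite by `finiteFibres_totalList`. This yields the explicit
formula for `Δ(a_ν)` and the compatibility with substitution.

By distributivity both comultiplications have the same expansion on products of generators
(`PLin.comul_list`, `comul_forestElt`), and these products form a basis on each side, so the evident
isomorphism of algebras respects comultiplications and counits.

Coassociativity is proved for the free algebra, where it suffices to treat generators: both iterated
coproducts are sums over decompositions with three levels (`Dec.sum_fib_assoc`). The axioms for the
incidence bialgebra are then transported along the isomorphism. -/

noncomputable section

namespace Pleth

/-! ## Finite fibres -/

section Fibre

variable {A B : Type*}

/-- A map all of whose fibres are finite. -/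
def FiniteFibres (f : A → B) : Prop := ∀ b, {a | f a = b}.Finite

variable {f : A → B}

/-- The fibre of a map with finite fibres, as a `Finset`. -/
def FiniteFibres.fibre (hf : FiniteFibres f) (b : B) : Finset A := (hf b).toFinset

@[simp]
theorem FiniteFibres.mem_fibre (hf : FiniteFibres f) {a : A} {b : B} :
    a ∈ hf.fibre b ↔ f a = b := by
  simp [FiniteFibres.fibre]

theorem FiniteFibres.listMap (hf : FiniteFibres f) : FiniteFibres (List.map f) := by
  intro l
  induction l with
  | nil => exact (Set.finite_singleton []).subset fun l hl => List.map_eq_nil_iff.1 hl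
  | cons b l ih =>
    refine ((hf b).image2 List.cons ih).subset fun m hm => ?_
    obtain ⟨a, m', rfl, ha, hm'⟩ := List.map_eq_cons_iff.1 (show m.map f = b :: l from hm)
    exact ⟨a, ha, m', hm', rfl⟩

theorem FiniteFibres.sum_fibre_listMap_cons {M : Type*} [AddCommMonoid M] (hf : FiniteFibres f)
    (b : B) (l : List B) (g : List A → M) :
    ∑ m ∈ hf.listMap.fibre (b :: l), g m =
      ∑ a ∈ hf.fibre b, ∑ m ∈ hf.listMap.fibre l, g (a :: m) := by
  rw [← Finset.sum_product']
  symm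
  refine Finset.sum_nbij (fun p => p.1 :: p.2) ?_ ?_ ?_ (fun _ _ => rfl)
  · rintro ⟨a, m⟩ h
    simpa using h
  · rintro ⟨a, m⟩ _ ⟨a', m'⟩ _ h
    simpa using h
  · intro m hm
    have hm : m.map f = b :: l := by simpa using hm
    obtain ⟨a, m', rfl, ha, hm'⟩ := List.map_eq_cons_iff.1 hm
    exact ⟨(a, m'), by simp [ha, hm'], rfl⟩

theorem FiniteFibres.sum_fibre_listMap_nil {M : Type*} [AddCommMonoid M] (hf : FiniteFibres f)
    (g : List A → M) : ∑ m ∈ hf.listMap.fibre [], g m = g [] := by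
  have : hf.listMap.fibre [] = {[]} := by
    ext m
    simp
  rw [this, Finset.sum_singleton]

/-- Distributivity, with the order of the factors kept. It turns a product of coproducts of
generators into one sum over sequences of decompositions. -/
theorem FiniteFibres.sum_fibre_listMap_prod {S : Type*} [Semiring S] (hf : FiniteFibres f)
    (h : A → S) (l : List B) :
    ∑ m ∈ hf.listMap.fibre l, (m.map h).prod =
      (l.map fun b => ∑ a ∈ hf.fibre b, h a).prod := by
  induction l with
  | nil => simp [hf.sum_fibre_listMap_nil]
  | cons b l ih =>
    rw [hf.sum_fibre_listMap_cons, List.map_cons, List.prod_cons, ← ih, Finset.sum_mul_sum]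
    simp

end Fibre

/-! ## Decompositions of words -/

/-- The concatenation `k₁ w₁ + ⋯ + kₙ wₙ`. -/
def totalList (p : List (ℕ+ × Word)) : List ℕ+ := p.flatMap fun x => (versch x.1 x.2).1

@[simp] theorem totalList_nil : totalList [] = [] := rfl

@[simp] theorem totalList_cons (x : ℕ+ × Word) (p : List (ℕ+ × Word)) :
    totalList (x :: p) = (versch x.1 x.2).1 ++ totalList p := rfl

theorem totalList_ne {p : List (ℕ+ × Word)} (h : p ≠ []) : totalList p ≠ [] := by
  cases p with
  | nil => exact absurd rfl h
  | cons x p => exact fun h0 => (versch x.1 x.2).2 (List.append_eq_nil_iff.1 h0).1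

theorem versch_injective (k : ℕ+) : Function.Injective (versch k)  := fun _ _ h =>
  Subtype.ext ((List.map_injective_iff.2 (mul_right_injective k)) (congrArg Subtype.val h))

/-- The scalar `k` divides the first letter of `l`, so it is bounded, and `k` determines the word by
cancellation. -/
theorem finite_versch_eq (l : List ℕ+) : {x : ℕ+ × Word | (versch x.1 x.2).1 = l}.Finite := by
  cases l with
  | nil => exact Set.finite_empty.subset fun x hx => (versch x.1 x.2).2 hx
  | cons m l =>
    refine Set.Finite.of_finite_image (f := Prod.fst) ((Set.finite_Iic m).subset ?_) ?_
    · rintro _ ⟨⟨k, w⟩, hx, rfl⟩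
      obtain ⟨w, hw⟩ := w
      cases w with
      | nil => exact absurd rfl hw
      | cons n w =>
        have : k * n = m := (List.cons.inj hx).1
        rw [Set.mem_Iic, ← this]
        exact le_mul_of_one_le_right' one_le
    · rintro ⟨k, w⟩ hx ⟨k', w'⟩ hx' (rfl : k = k')
      exact Prod.ext rfl (versch_injective k (Subtype.ext (Eq.trans hx (Eq.symm hx'))))

/-- Induction on the length of the word. Since the `κᵢ` are nonempty, removing the first piece
shortens what is left. -/
theorem finiteFibres_totalList : FiniteFibres totalList := by
  suffices ∀ (n : ℕ) (l : List ℕ+), l.length ≤ n → {p | totalList p = l}.Finite from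
    fun l => this _ l le_rfl
  intro n
  induction n with
  | zero =>
    intro l hl
    obtain rfl : l = [] := List.length_eq_zero_iff.1 (by omega)
    exact (Set.finite_singleton []).subset fun p hp => by
      by_contra h
      exact totalList_ne h hp
  | succ n ih =>
    intro l hl
    -- The index `i` is the length of the first piece; it starts at 1 because words are nonempty,
    -- which is what lets `ih` apply to `l.drop i`.
    have key : ∀ i ∈ Finset.Icc 1 l.length, (Set.image2 List.cons
        {x : ℕ+ × Word | (versch x.1 x.2).1 = l.take i} {p | totalList p = l.drop i}).Finite := by
      intro i hi
      rw [Finset.mem_Icc] at hi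
      exact (finite_versch_eq _).image2 _ (ih _ (by rw [List.length_drop]; omega))
    refine ((Set.finite_singleton []).union
      (Set.Finite.biUnion (Finset.Icc 1 l.length).finite_toSet key)).subset ?_
    rintro (_ | ⟨x, p⟩) hp
    · exact Or.inl rfl
    · right
      obtain rfl : (versch x.1 x.2).1 ++ totalList p = l := hp
      have := List.length_pos_of_ne_nil (versch x.1 x.2).2
      simp only [Set.mem_iUnion]
      exact ⟨(versch x.1 x.2).1.length, by simp; omega, x, by simp, p, by simp, rfl⟩

/-- Nonempty sequences of pairs of a positive integer and a word. -/
abbrev Dec : Type := {p : List (ℕ+ × Word) // p ≠ []}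

namespace Dec

/-- The word `ω` of a sequence of pairs `(ω₁, κ₁), …, (ωₙ, κₙ)`. -/
def outer (d : Dec) : Word := ⟨d.1.map Prod.fst, fun h => d.2 (List.map_eq_nil_iff.1 h)⟩

/-- The sequence of words `κ` of a sequence of pairs `(ω₁, κ₁), …, (ωₙ, κₙ)`. -/
def inner (d : Dec) : List Word := d.1.map Prod.snd

/-- The word `ω₁ κ₁ + ⋯ + ωₙ κₙ`. -/
def total (d : Dec) : Word := ⟨totalList d.1, totalList_ne d.2⟩

theorem finiteFibres_total : FiniteFibres total := fun w =>
  Set.Finite.of_finite_image (f := Subtype.val)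
    ((finiteFibres_totalList w.1).subset (by rintro _ ⟨d, rfl, rfl⟩; rfl))
    Subtype.val_injective.injOn

/-- The decompositions of a word. -/
def fib (ν : Word) : Finset Dec := finiteFibres_total.fibre ν

@[simp]
theorem mem_fib {d : Dec} {ν : Word} : d ∈ fib ν ↔ d.total = ν :=
  finiteFibres_total.mem_fibre

/-- The pair `(ω, κ)` given by a sequence of pairs. -/
def pair (d : Dec) : Word × List Word := (d.outer, d.inner)

theorem pair_injective : Function.Injective pair := by
  intro d d' h
  obtain ⟨h₁, h₂⟩ := Prod.ext_iff.1 h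
  have h₁ : d.1.map Prod.fst = d'.1.map Prod.fst := congrArg Subtype.val h₁
  have h₂ : d.1.map Prod.snd = d'.1.map Prod.snd := h₂
  apply Subtype.ext
  have := List.zip_of_prod h₁ h₂
  rw [this]
  exact (List.zip_of_prod rfl rfl).symm

theorem totalList_zip : ∀ (l : List ℕ+) (κ : List Word),
    totalList (l.zip κ) = (List.zipWith (fun k w => (versch k w).1) l κ).flatten
  | [], _ => rfl
  | _ :: _, [] => rfl
  | k :: l, w :: κ => by
    rw [List.zip_cons_cons, totalList_cons, totalList_zip l κ]
    rfl

/-- The condition on lengths is what makes zipping `ω` with `κ` lossless. -/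
theorem decompositions_eq (ν : Word) : decompositions ν = pair '' (fib ν) := by
  ext ⟨⟨ω, hω⟩, κ⟩
  constructor
  · rintro ⟨hl, ht⟩
    have hl : κ.length = ω.length := hl
    have h₁ : (ω.zip κ).map Prod.fst = ω := List.map_fst_zip hl.ge
    have h₂ : (ω.zip κ).map Prod.snd = κ := List.map_snd_zip hl.le
    refine ⟨⟨ω.zip κ, fun h => hω (by rw [← h₁, h]; rfl)⟩, ?_, ?_⟩
    · rw [Finset.mem_coe, mem_fib]
      exact Subtype.ext ((totalList_zip ω κ).trans ht)
    · exact Prod.ext (Subtype.ext h₁) h₂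
  · rintro ⟨d, hd, h⟩
    rw [Finset.mem_coe, mem_fib] at hd
    obtain ⟨h₁, rfl⟩ := Prod.ext_iff.1 h
    obtain rfl : d.1.map Prod.fst = ω := congrArg Subtype.val h₁
    refine ⟨by simp [inner, pair], ?_⟩
    have hz : (d.1.map Prod.fst).zip d.inner = d.1 := (List.zip_of_prod rfl rfl).symm
    exact (totalList_zip _ _).symm.trans ((congrArg totalList hz).trans (congrArg Subtype.val hd))

theorem decompositions_finite (ν : Word) : (decompositions ν).Finite := by
  rw [decompositions_eq]
  exact (fib ν).finite_toSet.image _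

theorem finsum_decompositions {M : Type*} [AddCommMonoid M] (ν : Word) (g : Word × List Word → M) :
    ∑ᶠ p ∈ decompositions ν, g p = ∑ d ∈ fib ν, g d.pair := by
  rw [decompositions_eq, finsum_mem_image pair_injective.injOn, finsum_mem_coe_finset]

end Dec

/-! ## Two-step decompositions -/

namespace Dec

/-- Two-step decompositions, as sequences of pairs of a positive integer and a decomposition. -/
abbrev Two : Type := {u : List (ℕ+ × Dec) // u ≠ []}

namespace Two

/-- Composition of the two lower levels. -/
def lower (u : Two) : Dec :=
  ⟨u.1.map fun x => (x.1, x.2.total), fun h => u.2 (List.map_eq_nil_iff.1 h)⟩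

/-- Removal of the lowest level. -/
def top (u : Two) : Dec :=
  ⟨u.1.map fun x => (x.1, x.2.outer), fun h => u.2 (List.map_eq_nil_iff.1 h)⟩

/-- Multiplication of the positive integers of a sequence of pairs. -/
def scale (k : ℕ+) (p : List (ℕ+ × Word)) : List (ℕ+ × Word) := p.map fun y => (k * y.1, y.2)

/-- Composition of the two upper levels, on sequences. -/
def upperList (u : List (ℕ+ × Dec)) : List (ℕ+ × Word) := u.flatMap fun x => scale x.1 x.2.1

theorem upperList_ne {u : List (ℕ+ × Dec)} (h : u ≠ []) : upperList u ≠ [] := by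
  cases u with
  | nil => exact absurd rfl h
  | cons x u => exact fun h0 => x.2.2 (List.map_eq_nil_iff.1 (List.append_eq_nil_iff.1 h0).1)

/-- Composition of the two upper levels. -/
def upper (u : Two) : Dec := ⟨upperList u.1, upperList_ne u.2⟩

theorem totalList_scale (k : ℕ+) (p : List (ℕ+ × Word)) :
    totalList (scale k p) = (totalList p).map (k * ·) := by
  simp [totalList, scale, List.flatMap_map, List.map_flatMap, versch, Function.comp_def, mul_assoc]

/-- Associativity of multiplication of positive integers. Here `lower`, `upper` and `top` play the
roles of `d₁`, `d₂` and `d₀` from degree 3, and this is the simplicial identity `d₁ d₂ = d₁ d₁`. -/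
theorem total_upper (u : Two) : u.upper.total = u.lower.total := by
  apply Subtype.ext
  change totalList (upperList u.1) = totalList (u.1.map _)
  induction u.1 with
  | nil => rfl
  | cons x l ih =>
    rw [List.map_cons, totalList_cons, ← ih]
    change totalList (scale _ _ ++ upperList l) = _
    rw [totalList, List.flatMap_append]
    exact congrArg (· ++ _) (totalList_scale _ _)

/-- The simplicial identity `d₁ d₀ = d₀ d₂`. -/
theorem total_top (u : Two) : u.top.total = u.upper.outer := by
  apply Subtype.ext
  change totalList (u.1.map _) = (upperList u.1).map Prod.fst
  simp [totalList, upperList, scale, List.flatMap_map, List.map_flatMap, versch, outer,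
    Function.comp_def]

theorem inner_lower (u : Two) : u.lower.inner = (u.1.map Prod.snd).map total := by
  simp [lower, inner]

theorem outer_lower (u : Two) : u.lower.outer = u.top.outer := by
  apply Subtype.ext
  simp [lower, top, outer]

theorem inner_top (u : Two) : u.top.inner = (u.1.map Prod.snd).map outer := by
  simp [top, inner]

theorem inner_upper (u : Two) : u.upper.inner = (u.1.map Prod.snd).flatMap inner := by
  simp [upper, upperList, inner, scale, List.flatMap_map, List.map_flatMap, Function.comp_def]

/-- Together with `lower_surjective`: a three-level decomposition is a decomposition `d` along with
a decomposition of each of its inner words. -/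
theorem lower_injective : Function.Injective fun u : Two => (u.lower, u.1.map Prod.snd) := by
  intro u u' h
  obtain ⟨h₁, h₂⟩ := Prod.ext_iff.1 h
  have h₁ : u.1.map Prod.fst = u'.1.map Prod.fst := by
    have := congrArg (fun d : Dec => d.1.map Prod.fst) h₁
    simpa [lower, Function.comp_def] using this
  apply Subtype.ext
  rw [List.zip_of_prod h₁ h₂]
  exact (List.zip_of_prod rfl rfl).symm

theorem lower_surjective (d : Dec) (q : List Dec) (h : q.map total = d.inner) :
    ∃ u : Two, u.lower = d ∧ u.1.map Prod.snd = q := by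
  obtain ⟨d, hd⟩ := d
  suffices ∀ (d : List (ℕ+ × Word)) (q : List Dec), q.map total = d.map Prod.snd →
      ∃ u : List (ℕ+ × Dec), u.map (fun x => (x.1, x.2.total)) = d ∧ u.map Prod.snd = q by
    obtain ⟨u, hu, hq⟩ := this d q h
    exact ⟨⟨u, fun h0 => hd (by rw [← hu, h0]; rfl)⟩, Subtype.ext hu, hq⟩
  intro d
  induction d with
  | nil => exact fun q hq => ⟨[], rfl, (List.map_eq_nil_iff.1 hq).symm⟩
  | cons x d ih =>
    intro q hq
    obtain ⟨y, q', rfl, hy, hq'⟩ := List.map_eq_cons_iff.1 hq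
    obtain ⟨u, rfl, rfl⟩ := ih q' hq'
    exact ⟨(x.1, y) :: u, by simp [hy], rfl⟩

theorem scale_injective (k : ℕ+) : Function.Injective (scale k) :=
  List.map_injective_iff.2 fun y y' h => by
    obtain ⟨h₁, h₂⟩ := Prod.ext_iff.1 h
    exact Prod.ext (mul_left_cancel h₁) h₂

/-- Together with `upper_surjective`: a three-level decomposition is a decomposition `p` along with
a decomposition of its outer word. The list `upperList u` forgets where its blocks end, but `top`
records their lengths, so the blocks can be cut out again and the scalar cancelled. -/
theorem upper_injective : Function.Injective fun u : Two => (u.upper, u.top) := by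
  suffices ∀ u u' : List (ℕ+ × Dec), upperList u = upperList u' →
      u.map (fun x => (x.1, x.2.outer)) = u'.map (fun x => (x.1, x.2.outer)) → u = u' by
    intro u u' h
    obtain ⟨h₁, h₂⟩ := Prod.ext_iff.1 h
    exact Subtype.ext (this _ _ (congrArg Subtype.val h₁) (congrArg Subtype.val h₂))
  intro u
  induction u with
  | nil => exact fun u' _ h => (List.map_eq_nil_iff.1 h.symm).symm
  | cons x u ih =>
    rintro (_ | ⟨x', u'⟩) h₁ h₂
    · simp at h₂
    · obtain ⟨k, q⟩ := x
      obtain ⟨k', q'⟩ := x'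
      obtain ⟨h₃, h₄⟩ := List.cons.inj h₂
      obtain ⟨h₅, h₆⟩ := Prod.ext_iff.1 h₃
      obtain rfl : k = k' := h₅
      have hlen : q.1.length = q'.1.length := by
        have := congrArg (fun w : Word => w.1.length) h₆
        simpa [outer] using this
      obtain ⟨h₇, h₈⟩ := List.append_inj (show scale k q.1 ++ upperList u =
        scale k q'.1 ++ upperList u' from h₁) (by simp [scale, hlen])
      rw [ih _ h₈ h₄, Subtype.ext (scale_injective k h₇)]

theorem exists_scale (k : ℕ+) : ∀ (w : List ℕ+) (p : List (ℕ+ × Word)),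
    p.map Prod.fst = w.map (k * ·) → ∃ q, q.map Prod.fst = w ∧ scale k q = p
  | [], p, h => ⟨[], rfl, (List.map_eq_nil_iff.1 h).symm⟩
  | n :: w, p, h => by
    obtain ⟨y, p', rfl, hy, hp'⟩ := List.map_eq_cons_iff.1 h
    obtain ⟨q, rfl, rfl⟩ := exists_scale k w p' hp'
    exact ⟨(n, y.2) :: q, rfl, by simp [scale, ← hy]⟩

/-- The integers of `p` read as the concatenation of the pieces of `r`; cutting `p` at the ends of
these pieces and dividing each block by its scalar (`exists_scale`) gives `u`. -/
theorem upper_surjective (p r : Dec) (h : r.total = p.outer) :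
    ∃ u : Two, u.upper = p ∧ u.top = r := by
  obtain ⟨p, hp⟩ := p
  obtain ⟨r, hr⟩ := r
  suffices ∀ r p : List (ℕ+ × Word), totalList r = p.map Prod.fst →
      ∃ u : List (ℕ+ × Dec), upperList u = p ∧ u.map (fun x => (x.1, x.2.outer)) = r by
    obtain ⟨u, hu, hq⟩ := this r p (congrArg Subtype.val h)
    exact ⟨⟨u, fun h0 => hr (by rw [← hq, h0]; rfl)⟩, Subtype.ext hu, Subtype.ext hq⟩
  intro r
  induction r with
  | nil => exact fun p hp => ⟨[], (List.map_eq_nil_iff.1 hp.symm).symm, rfl⟩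
  | cons x r ih =>
    intro p hp
    rw [totalList_cons] at hp
    obtain ⟨p₁, p₂, rfl, h₁, h₂⟩ := List.map_eq_append_iff.1 hp.symm
    obtain ⟨u, rfl, rfl⟩ := ih p₂ h₂.symm
    obtain ⟨q, hq, rfl⟩ := exists_scale x.1 x.2.1 p₁ h₁
    refine ⟨(x.1, ⟨q, fun h0 => x.2.2 (by rw [← hq, h0]; rfl)⟩) :: u, rfl, ?_⟩
    rw [List.map_cons]
    exact congrArg (· :: _) (Prod.ext rfl (Subtype.ext hq))

end Two

/-- Two-step decompositions may be summed from the root or from the leaves. -/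
theorem sum_fib_assoc {M : Type*} [AddCommMonoid M] (ν : Word)
    (g : List Word → List Word → Word → M) :
    ∑ d ∈ fib ν, ∑ q ∈ finiteFibres_total.listMap.fibre d.inner,
        g (q.flatMap inner) (q.map outer) d.outer =
      ∑ p ∈ fib ν, ∑ r ∈ fib p.outer, g p.inner r.inner r.outer := by
  -- Finiteness comes from `lower_injective`, which embeds this set in the finite index set of the
  -- left-hand double sum.
  have hfin : {u : Two | u.lower.total = ν}.Finite := by
    refine Set.Finite.of_finite_image (f := fun u : Two => (u.lower, u.1.map Prod.snd)) ?_
      Two.lower_injective.injOn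
    refine ((fib ν).sigma
      fun d => finiteFibres_total.listMap.fibre d.inner).finite_toSet.image
        (fun x => (x.1, x.2)) |>.subset ?_
    rintro _ ⟨u, hu, rfl⟩
    exact ⟨⟨u.lower, u.1.map Prod.snd⟩, by simpa [Two.inner_lower] using hu, rfl⟩
  rw [Finset.sum_sigma', Finset.sum_sigma']
  -- Both double sums are reindexed by three-level decompositions: the left one through `lower`, the
  -- right one through `upper` and `top`.
  trans ∑ u ∈ hfin.toFinset, g u.upper.inner u.top.inner u.top.outer
  · symm
    refine Finset.sum_nbij (fun u => ⟨u.lower, u.1.map Prod.snd⟩) ?_ ?_ ?_ ?_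
    · intro u hu
      simpa [Two.inner_lower] using hu
    · intro u _ u' _ h
      obtain ⟨h₁, h₂⟩ := Sigma.mk.inj h
      exact Two.lower_injective (Prod.ext h₁ (eq_of_heq h₂))
    · rintro ⟨d, q⟩ hx
      simp only [Finset.coe_sigma, Set.mem_sigma_iff, Finset.mem_coe, mem_fib,
        FiniteFibres.mem_fibre] at hx
      obtain ⟨u, rfl, rfl⟩ := Two.lower_surjective d q hx.2
      exact ⟨u, by simpa using hx.1, rfl⟩
    · intro u _
      rw [Two.inner_upper, Two.inner_top, Two.outer_lower]
  · refine Finset.sum_nbij (fun u => ⟨u.upper, u.top⟩) ?_ ?_ ?_ (fun _ _ => rfl)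
    · intro u hu
      simpa [Two.total_upper, Two.total_top] using hu
    · intro u _ u' _ h
      obtain ⟨h₁, h₂⟩ := Sigma.mk.inj h
      exact Two.upper_injective (Prod.ext h₁ (eq_of_heq h₂))
    · rintro ⟨p, r⟩ hx
      simp only [Finset.coe_sigma, Set.mem_sigma_iff, Finset.mem_coe, mem_fib] at hx
      obtain ⟨u, rfl, rfl⟩ := Two.upper_surjective p r hx.2
      exact ⟨u, by simpa [Two.total_upper] using hx.1, rfl⟩

end Dec

/-! ## The coefficients of a plethystic substitution -/

section Substitution

variable {R : Type*} [Ring R]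

theorem finite_versch_fixed (k : ℕ+) (l : List ℕ+) : {v : Word | (versch k v).1 = l}.Finite :=
  Set.Subsingleton.finite fun _ h _ h' =>
    versch_injective k (Subtype.ext (Eq.trans h (Eq.symm h')))

/-- A coefficient of a product of series sums over the cuttings of `ν` into consecutive pieces, and
the `i`th piece contributes only if it is the `i`th letter of `l` times a word. An empty piece
contributes nothing, as words are nonempty. -/
theorem seriesProd_dilate (F : Word → R) (l ν : List ℕ+) :
    seriesProd (l.map fun k => dilate k F) ν =
      ∑ p ∈ finiteFibres_totalList.fibre ν with p.map Prod.fst = l,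
        (p.map fun x => F x.2).prod := by
  induction l generalizing ν with
  | nil =>
    have : (finiteFibres_totalList.fibre ν).filter (fun p => p.map Prod.fst = []) =
        if ν = [] then {[]} else ∅ := by
      ext p
      split_ifs with h <;> aesop
    rw [this]
    change (if ν = [] then 1 else 0) = _
    split_ifs <;> simp
  | cons k l ih =>
    change seriesMul (dilate k F) (seriesProd (l.map fun k => dilate k F)) ν = _
    have hd : ∀ w, dilate k F w = ∑ v ∈ (finite_versch_fixed k w).toFinset, F v := fun w =>
      finsum_mem_eq_finite_toFinset_sum _ _
    simp only [seriesMul, ih, hd, Finset.sum_mul_sum, Finset.sum_sigma']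
    refine Finset.sum_nbij (fun x => (k, x.2.1) :: x.2.2) ?_ ?_ ?_ ?_
    · rintro ⟨i, v, p⟩ h
      simp only [Finset.mem_sigma, Finset.mem_range, Set.Finite.mem_toFinset, Set.mem_ofPred_eq,
        Finset.mem_filter, FiniteFibres.mem_fibre] at h
      obtain ⟨-, h₁, h₂, h₃⟩ := h
      simp [h₁, h₂, h₃]
    · rintro ⟨i, v, p⟩ h ⟨i', v', p'⟩ h' e
      simp only [Finset.coe_sigma, Set.mem_sigma_iff, Finset.mem_coe, Finset.mem_range,
        Set.Finite.mem_toFinset, Set.mem_ofPred_eq] at h h'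
      obtain ⟨e₁, rfl⟩ := List.cons.inj e
      obtain rfl : v = v' := congrArg Prod.snd e₁
      -- The position of the cut is not kept in the list of pairs, but it is the length of the first
      -- word, because `i` is at most the length of `ν`.
      have hi : i = i' := by
        have h₁ := congrArg List.length h.2.1
        have h₂ := congrArg List.length h'.2.1
        rw [List.length_take] at h₁ h₂
        omega
      rw [hi]
    · intro p hp
      simp only [Finset.coe_filter, FiniteFibres.mem_fibre, Set.mem_ofPred_eq] at hp
      obtain ⟨x, p', rfl, rfl, hp'⟩ := List.map_eq_cons_iff.1 hp.2
      obtain rfl := hp.1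
      refine ⟨⟨(versch x.1 x.2).1.length, x.2, p'⟩, ?_, rfl⟩
      simp [hp']
    · rintro ⟨i, v, p⟩ _
      simp

/-- The decompositions of `ν` are grouped according to their outer word. -/
theorem subst_eq_sum (G F : Word → R) (ν : Word) :
    subst G F ν = ∑ d ∈ Dec.fib ν, G d.outer * (d.inner.map F).prod := by
  have key : ∀ ω : Word, G ω * seriesProd (ω.1.map fun k => dilate k F) ν.1 =
      ∑ d ∈ Dec.fib ν with d.outer = ω, G d.outer * (d.inner.map F).prod := by
    intro ω
    rw [seriesProd_dilate, Finset.mul_sum]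
    symm
    refine Finset.sum_nbij Subtype.val ?_ Subtype.val_injective.injOn ?_ ?_
    · intro d hd
      rw [Finset.mem_filter, Dec.mem_fib] at hd
      rw [Finset.mem_filter, FiniteFibres.mem_fibre]
      exact ⟨congrArg Subtype.val hd.1, congrArg Subtype.val hd.2⟩
    · intro p hp
      simp only [Finset.coe_filter, FiniteFibres.mem_fibre, Set.mem_ofPred_eq] at hp
      refine ⟨⟨p, fun h => ω.2 (by rw [← hp.2, h]; rfl)⟩, ?_, rfl⟩
      simp only [Finset.coe_filter, Dec.mem_fib, Set.mem_ofPred_eq]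
      exact ⟨Subtype.ext hp.1, Subtype.ext hp.2⟩
    · intro d hd
      rw [Finset.mem_filter] at hd
      rw [hd.2, Dec.inner, List.map_map]
      rfl
  rw [subst, finsum_congr key, ← Finset.sum_fiberwise_of_maps_to
    (s := Dec.fib ν) (t := (Dec.fib ν).image Dec.outer) (g := Dec.outer)
    fun d hd => Finset.mem_image_of_mem _ hd]
  -- Only outer words of decompositions of `ν` contribute, so the support is finite and `finsum`
  -- does not take its default value.
  refine finsum_eq_sum_of_support_subset _ fun ω hω => ?_
  obtain ⟨d, hd, -⟩ := Finset.exists_ne_zero_of_sum_ne_zero hω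
  rw [Finset.mem_filter] at hd
  rw [Finset.mem_coe, ← hd.2]
  exact Finset.mem_image_of_mem _ hd.1

end Substitution

/-! ### The bialgebra axioms for the free algebra -/

namespace PLin

theorem prod_map_left (κ : List Word) :
    (κ.map fun w => (a w ⊗ₜ[ℚ] (1 : PLin))).prod = (κ.map a).prod ⊗ₜ[ℚ] (1 : PLin) := by
  have := map_list_prod
    (Algebra.TensorProduct.includeLeft : PLin →ₐ[ℚ] PLin ⊗[ℚ] PLin) (κ.map a)
  rw [List.map_map] at this
  exact this.symm

theorem comul_a (ν : Word) :
    comul (a ν) = ∑ d ∈ Dec.fib ν, (d.inner.map a).prod ⊗ₜ[ℚ] a d.outer := by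
  rw [comul, a, FreeAlgebra.lift_ι_apply, subst_eq_sum]
  refine Finset.sum_congr rfl fun d _ => ?_
  rw [prod_map_left, Algebra.TensorProduct.tmul_mul_tmul, one_mul, mul_one]

/-- For noncommutative `R` the map `evalPair F G` need not be multiplicative, so the comparison is
made term by term, using only that each of the two evaluations is an algebra map. -/
theorem evalPair_comul {R : Type*} [Ring R] [Algebra ℚ R] (F G : Word → R) (ν : Word) :
    evalPair F G (comul (a ν)) = subst G F ν := by
  rw [comul_a, map_sum, subst_eq_sum]
  refine Finset.sum_congr rfl fun d _ => ?_
  have h₁ : evalSeries G (a d.outer) = G d.outer := FreeAlgebra.lift_ι_apply _ _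
  have h₂ : evalSeries F (d.inner.map a).prod = (d.inner.map F).prod := by
    rw [map_list_prod, List.map_map]
    exact congrArg (fun f => (d.inner.map f).prod) (funext fun w => FreeAlgebra.lift_ι_apply _ _)
  exact congrArg₂ (· * ·) h₁ h₂

/-- The coproduct of a monomial, in the form in which it is met both in coassociativity and in
degree 2 of the bar construction. -/
theorem comul_list (κ : List Word) :
    comul (κ.map a).prod = ∑ q ∈ Dec.finiteFibres_total.listMap.fibre κ,
      ((q.flatMap Dec.inner).map a).prod ⊗ₜ[ℚ] ((q.map Dec.outer).map a).prod := by
  have h : ∀ q : List Dec, ((q.flatMap Dec.inner).map a).prod ⊗ₜ[ℚ] ((q.map Dec.outer).map a).prod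
      = (q.map fun d => (d.inner.map a).prod ⊗ₜ[ℚ] a d.outer).prod := by
    intro q
    induction q with
    | nil => rfl
    | cons d q ih =>
      rw [List.map_cons (f := fun d : Dec => (d.inner.map a).prod ⊗ₜ[ℚ] a d.outer),
        List.prod_cons, ← ih, Algebra.TensorProduct.tmul_mul_tmul]
      simp
  rw [Finset.sum_congr rfl fun q _ => h q, Dec.finiteFibres_total.sum_fibre_listMap_prod,
    map_list_prod, List.map_map]
  exact congrArg (fun f => (κ.map f).prod) (funext fun w => comul_a w)

theorem coassoc : (Algebra.TensorProduct.assoc ℚ ℚ ℚ PLin PLin PLin).toAlgHom.comp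
      ((Algebra.TensorProduct.map comul (.id ℚ PLin)).comp comul)
      = (Algebra.TensorProduct.map (.id ℚ PLin) comul).comp comul := by
  refine FreeAlgebra.hom_ext (funext fun ν => ?_)
  change Algebra.TensorProduct.assoc ℚ ℚ ℚ PLin PLin PLin
      (Algebra.TensorProduct.map comul (.id ℚ PLin) (comul (a ν))) =
    Algebra.TensorProduct.map (.id ℚ PLin) comul (comul (a ν))
  simp only [comul_a, map_sum, Algebra.TensorProduct.map_tmul, AlgHom.id_apply, comul_list,
    TensorProduct.sum_tmul, TensorProduct.tmul_sum, Algebra.TensorProduct.assoc_tmul]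
  -- The left side decomposes the inner words of a decomposition of `ν`, the right side its outer
  -- word.
  exact Dec.sum_fib_assoc ν fun κ l ω => (κ.map a).prod ⊗ₜ[ℚ] ((l.map a).prod ⊗ₜ[ℚ] a ω)

theorem counit_a (w : Word) : counit (a w) = if w.1 = [1] then 1 else 0 :=
  FreeAlgebra.lift_ι_apply _ _

theorem counit_list (κ : List Word) :
    counit (κ.map a).prod = if ∀ w ∈ κ, w.1 = [1] then 1 else 0 := by
  induction κ with
  | nil => simp
  | cons w κ ih =>
    rw [List.map_cons, List.prod_cons, map_mul, ih, counit_a]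
    have h := List.forall_mem_cons (p := fun w : Word => w.1 = [1]) (a := w) (l := κ)
    by_cases h₁ : w.1 = [1] <;> by_cases h₂ : ∀ w ∈ κ, w.1 = [1]
    · rw [if_pos h₁, if_pos h₂, if_pos (h.2 ⟨h₁, h₂⟩), mul_one]
    · rw [if_neg h₂, if_neg fun h' => h₂ (h.1 h').2, mul_zero]
    all_goals rw [if_neg h₁, if_neg fun h' => h₁ (h.1 h').1, zero_mul]

/-- The word with the single letter `1`. -/
def oneWord : Word := ⟨[1], by simp⟩

/-- The decomposition of a word into its letters. -/
def letters (ν : Word) : Dec :=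
  ⟨ν.1.map fun k => (k, oneWord), fun h => ν.2 (List.map_eq_nil_iff.1 h)⟩

theorem outer_letters (ν : Word) : (letters ν).outer = ν :=
  Subtype.ext (by simp [letters, Dec.outer, Function.comp_def])

theorem total_eq_outer {d : Dec} (h : ∀ w ∈ d.inner, w.1 = [1]) : d.total = d.outer := by
  apply Subtype.ext
  change totalList d.1 = d.1.map Prod.fst
  have h : ∀ x ∈ d.1, x.2.1 = [1] := fun x hx => h _ (List.mem_map_of_mem hx)
  rw [totalList, List.map_eq_flatMap]
  refine congrArg List.flatten (List.map_congr_left fun x hx => ?_)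
  simp [versch, h x hx]

/-- The counit kills every term except the one all of whose inner words are `1`; then `ω = ν`, which
is the decomposition `letters ν`. -/
theorem rTensor_counit : (Algebra.TensorProduct.map counit (.id ℚ PLin)).comp comul
      = (Algebra.TensorProduct.lid ℚ PLin).symm := by
  refine FreeAlgebra.hom_ext (funext fun ν => ?_)
  change Algebra.TensorProduct.map counit (.id ℚ PLin) (comul (a ν)) = 1 ⊗ₜ a ν
  have hl : ∀ w ∈ (letters ν).inner, w.1 = [1] := by
    simp [letters, Dec.inner, oneWord]
  simp only [comul_a, map_sum, Algebra.TensorProduct.map_tmul, AlgHom.id_apply]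
  rw [Finset.sum_eq_single (letters ν), counit_list, if_pos hl, outer_letters]
  · intro d hd hne
    rw [Dec.mem_fib] at hd
    rw [counit_list, if_neg, TensorProduct.zero_tmul]
    intro h
    apply hne
    apply Dec.pair_injective
    refine Prod.ext ?_ ?_
    · change d.outer = (letters ν).outer
      rw [outer_letters, ← total_eq_outer h, hd]
    · change d.inner = (letters ν).inner
      refine List.ext_getElem ?_ fun i h₁ h₂ => ?_
      · have := congrArg (fun w : Word => w.1.length) (total_eq_outer h)
        simp only [hd] at this
        simpa [letters, Dec.inner, Dec.outer] using this.symm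
      · exact Subtype.ext ((h _ (List.getElem_mem h₁)).trans (hl _ (List.getElem_mem h₂)).symm)
  · intro h
    refine absurd ?_ h
    rw [Dec.mem_fib, total_eq_outer hl, outer_letters]

theorem lTensor_counit : (Algebra.TensorProduct.map (.id ℚ PLin) counit).comp comul
      = (Algebra.TensorProduct.rid ℚ ℚ PLin).symm := by
  refine FreeAlgebra.hom_ext (funext fun ν => ?_)
  change Algebra.TensorProduct.map (.id ℚ PLin) counit (comul (a ν)) = a ν ⊗ₜ 1
  simp only [comul_a, map_sum, Algebra.TensorProduct.map_tmul, AlgHom.id_apply]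
  have one_versch : versch 1 ν = ν := Subtype.ext (by simp [versch])
  -- The counit forces the outer word to be `1`, and then the only inner word is `ν`.
  rw [Finset.sum_eq_single ⟨[(1, ν)], by simp⟩]
  · simp [counit_a, Dec.outer, Dec.inner]
  · intro d hd hne
    rw [Dec.mem_fib] at hd
    rw [counit_a, if_neg, TensorProduct.tmul_zero]
    intro h
    apply hne
    obtain ⟨x, p, hp, hx, hp'⟩ := List.map_eq_cons_iff.1 h
    obtain rfl := List.map_eq_nil_iff.1 hp'
    obtain ⟨k, w⟩ := x
    obtain rfl : k = 1 := hx
    have : versch 1 w = ν := by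
      rw [← hd]
      exact Subtype.ext (by simp [Dec.total, hp])
    rw [← one_versch] at this
    rw [← versch_injective 1 this]
    exact Subtype.ext hp
  · intro h
    refine absurd ?_ h
    rw [Dec.mem_fib]
    exact Subtype.ext (by simp [Dec.total, one_versch])

theorem isBialgebra : IsBialgebra PLin comul.toLinearMap counit.toLinearMap where
  coassoc := congrArg AlgHom.toLinearMap coassoc
  rTensor_counit := congrArg AlgHom.toLinearMap rTensor_counit
  lTensor_counit := congrArg AlgHom.toLinearMap lTensor_counit
  comul_one := map_one comul
  comul_mul := map_mul comul
  counit_one := map_one counit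
  counit_mul := map_mul counit

end PLin

/-- A bialgebra structure may be transported along an isomorphism of algebras. -/
theorem IsBialgebra.of_algEquiv {A B : Type} [Ring A] [Algebra ℚ A] [Ring B] [Algebra ℚ B]
    {Δ : A →ₗ[ℚ] A ⊗[ℚ] A} {ε : A →ₗ[ℚ] ℚ} {Δ' : B →ₗ[ℚ] B ⊗[ℚ] B} {ε' : B →ₗ[ℚ] ℚ}
    (h : IsBialgebra A Δ ε) (e : A ≃ₐ[ℚ] B)
    (hΔ : ∀ x, Δ' (e x) = TensorProduct.map e.toLinearMap e.toLinearMap (Δ x))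
    (hε : ∀ x, ε' (e x) = ε x) : IsBialgebra B Δ' ε' where
  coassoc := by
    have h₁ : ∀ t : A ⊗[ℚ] A, TensorProduct.assoc ℚ B B B
        (Δ'.rTensor B (TensorProduct.map e.toLinearMap e.toLinearMap t)) =
        TensorProduct.map e.toLinearMap (TensorProduct.map e.toLinearMap e.toLinearMap)
          (TensorProduct.assoc ℚ A A A (Δ.rTensor A t)) := by
      intro t
      induction t with
      | zero => simp
      | add x y hx hy => simp only [map_add, hx, hy]
      | tmul x y =>
        simp only [TensorProduct.map_tmul, LinearMap.rTensor_tmul, AlgEquiv.toLinearMap_apply, hΔ]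
        induction Δ x with
        | zero => simp
        | add x y hx hy => simp only [map_add, TensorProduct.add_tmul, hx, hy]
        | tmul x z => simp
    have h₂ : ∀ t : A ⊗[ℚ] A,
        Δ'.lTensor B (TensorProduct.map e.toLinearMap e.toLinearMap t) =
        TensorProduct.map e.toLinearMap (TensorProduct.map e.toLinearMap e.toLinearMap)
          (Δ.lTensor A t) := by
      intro t
      induction t with
      | zero => simp
      | add x y hx hy => simp only [map_add, hx, hy]
      | tmul x y => simp [hΔ]
    refine LinearMap.ext fun y => ?_
    obtain ⟨x, rfl⟩ := e.surjective y
    have := LinearMap.congr_fun h.coassoc x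
    simp only [LinearMap.comp_apply, LinearEquiv.coe_coe] at this ⊢
    rw [hΔ, h₁, h₂, this]
  rTensor_counit := by
    have h₁ : ∀ t : A ⊗[ℚ] A, ε'.rTensor B (TensorProduct.map e.toLinearMap e.toLinearMap t) =
        e.toLinearMap.lTensor ℚ (ε.rTensor A t) := by
      intro t
      induction t with
      | zero => simp
      | add x y hx hy => simp only [map_add, hx, hy]
      | tmul x y => simp [hε]
    refine LinearMap.ext fun y => ?_
    obtain ⟨x, rfl⟩ := e.surjective y
    have := LinearMap.congr_fun h.rTensor_counit x
    rw [LinearMap.comp_apply] at this ⊢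
    rw [hΔ, h₁, this]
    simp
  lTensor_counit := by
    have h₁ : ∀ t : A ⊗[ℚ] A, ε'.lTensor B (TensorProduct.map e.toLinearMap e.toLinearMap t) =
        e.toLinearMap.rTensor ℚ (ε.lTensor A t) := by
      intro t
      induction t with
      | zero => simp
      | add x y hx hy => simp only [map_add, hx, hy]
      | tmul x y => simp [hε]
    refine LinearMap.ext fun y => ?_
    obtain ⟨x, rfl⟩ := e.surjective y
    have := LinearMap.congr_fun h.lTensor_counit x
    rw [LinearMap.comp_apply] at this ⊢
    rw [hΔ, h₁, this]
    simp
  comul_one := by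
    have := hΔ 1
    rw [map_one, h.comul_one] at this
    exact this.trans (map_one (Algebra.TensorProduct.map e.toAlgHom e.toAlgHom))
  comul_mul x y := by
    obtain ⟨x, rfl⟩ := e.surjective x
    obtain ⟨y, rfl⟩ := e.surjective y
    rw [← map_mul, hΔ, hΔ, hΔ, h.comul_mul]
    exact map_mul (Algebra.TensorProduct.map e.toAlgHom e.toAlgHom) _ _
  counit_one := by
    have := hε 1
    rwa [map_one, h.counit_one] at this
  counit_mul x y := by
    obtain ⟨x, rfl⟩ := e.surjective x
    obtain ⟨y, rfl⟩ := e.surjective y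
    rw [← map_mul, hε, hε, hε, h.counit_mul]

/-! ## Homotopy cardinality of groupoids without automorphisms -/

section Thin

theorem finite_aut {C : Type} [Category.{0} C] [Quiver.IsThin C] (x : C) : Finite (Aut x) :=
  @Finite.of_subsingleton _ ⟨fun _ _ => Iso.ext (Subsingleton.elim _ _)⟩

theorem card_aut {C : Type} [Category.{0} C] [Quiver.IsThin C] (x : C) : Nat.card (Aut x) = 1 :=
  @Nat.card_unique _ ⟨Iso.refl x⟩ ⟨fun _ _ => Iso.ext (Subsingleton.elim _ _)⟩

theorem hoCard_of_isThin (C : Type) [Category.{0} C] [Quiver.IsThin C] :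
    hoCard C = Nat.card (PiZero C) := by
  simp only [hoCard, card_aut, Nat.cast_one, div_one]
  rcases finite_or_infinite (PiZero C) with h | h
  · have := Fintype.ofFinite (PiZero C)
    rw [finsum_eq_sum_of_fintype]
    simp
  -- With infinitely many components both sides take the default value 0.
  · rw [Nat.card_eq_zero_of_infinite, finsum_of_infinite_support, Nat.cast_zero]
    convert Set.infinite_univ (α := PiZero C)
    exact Set.eq_univ_of_forall fun x => one_ne_zero

instance {A B : Type} [Groupoid.{0} A] [Groupoid.{0} B] [Quiver.IsThin A] (F : A ⥤ B) (b : B) :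
    Quiver.IsThin (HoFiber F b) := fun _ _ =>
  ⟨fun _ _ => CostructuredArrow.hom_ext _ _ (Subsingleton.elim _ _)⟩

instance {A B : Type} [Category.{0} A] [Category.{0} B] [Quiver.IsThin A] [Quiver.IsThin B] :
    Quiver.IsThin (A × B) := fun _ _ =>
  ⟨fun _ _ => Prod.ext (Subsingleton.elim _ _) (Subsingleton.elim _ _)⟩

instance {A : Type} : Quiver.IsThin (Discrete A) := fun _ _ => inferInstance

variable {A B : Type} [Groupoid.{0} A] [Groupoid.{0} B]

/-- The map on components induced by a functor. -/
def piZeroMap (F : A ⥤ B) : PiZero A → PiZero B :=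
  Quotient.map F.obj fun _ _ ⟨e⟩ => ⟨F.mapIso e⟩

/-- The components of the homotopy fibre of a map of groupoids without automorphisms. -/
def piZeroHoFiber [Quiver.IsThin B] (F : A ⥤ B) (b : B) :
    PiZero (HoFiber F b) ≃ {x : PiZero A // piZeroMap F x = cls b} :=
  Equiv.ofBijective
    (fun y => ⟨piZeroMap (CostructuredArrow.proj F b) y, by
      obtain ⟨y⟩ := y
      exact Quotient.sound ⟨(Groupoid.isoEquivHom _ _).symm y.hom⟩⟩) <| by
    constructor
    · rintro ⟨y⟩ ⟨z⟩ h
      obtain ⟨e⟩ := Quotient.exact (congrArg Subtype.val h)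
      -- The triangle over `b` commutes because `B` is thin.
      exact Quotient.sound ⟨CostructuredArrow.isoMk e (Subsingleton.elim _ _)⟩
    · rintro ⟨⟨x⟩, hx⟩
      obtain ⟨e⟩ := Quotient.exact hx
      exact ⟨cls (CostructuredArrow.mk (show F.obj x ⟶ b from e.hom)), Subtype.ext rfl⟩

theorem cls_out {C : Type} [Category.{0} C] (x : PiZero C) : cls x.out = x := Quotient.out_eq x

/-- The cardinality of a map from a finite groupoid, for groupoids without automorphisms. -/
theorem hoCardMap_of_isThin [Quiver.IsThin A] [Quiver.IsThin B] [Fintype (PiZero A)] (F : A ⥤ B) :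
    hoCardMap F = ∑ x : PiZero A, Finsupp.single (piZeroMap F x) (1 : ℚ) := by
  classical
  -- Without automorphisms, the coefficient of `b` is the number of components of `A` lying over
  -- `b`.
  have key : ∀ b : PiZero B,
      Finsupp.single b (hoCard (HoFiber F b.out) / (Nat.card (Aut b.out) : ℚ)) =
        ∑ x : PiZero A with piZeroMap F x = b, Finsupp.single (piZeroMap F x) (1 : ℚ) := by
    intro b
    rw [card_aut, hoCard_of_isThin, Nat.card_congr (piZeroHoFiber F b.out), cls_out,
      Finset.sum_congr rfl (g := fun _ => Finsupp.single b (1 : ℚ))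
        fun x hx => by rw [(Finset.mem_filter.1 hx).2], Finset.sum_const, Nat.card_eq_fintype_card,
      Fintype.card_subtype]
    simp
  rw [hoCardMap, finsum_congr key, ← Finset.sum_fiberwise_of_maps_to
    (t := Finset.univ.image (piZeroMap F)) (g := piZeroMap F)
    fun x hx => Finset.mem_image_of_mem _ hx]
  refine finsum_eq_sum_of_support_subset _ fun b hb => ?_
  obtain ⟨x, hx, -⟩ := Finset.exists_ne_zero_of_sum_ne_zero hb
  rw [Finset.mem_coe, ← (Finset.mem_filter.1 hx).2]
  exact Finset.mem_image_of_mem _ (Finset.mem_univ x)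

/-- The components of a discrete groupoid. -/
def piZeroDiscrete (A : Type) : PiZero (Discrete A) ≃ A where
  toFun := Quotient.lift Discrete.as fun _ _ ⟨e⟩ => Discrete.eq_of_hom e.hom
  invFun a := cls ⟨a⟩
  left_inv := by rintro ⟨x⟩; rfl
  right_inv _ := rfl

end Thin

/-! ### The incidence bialgebra of a simplicial monoid, by counting -/

namespace SimplicialMonoid

/-- The components of the homotopy fibre of a map of sets. -/
def piZeroHoFiberDisc {A B : Type} (f : A → B) (b : Discrete B) :
    PiZero (HoFiber (disc f) b) ≃ {x : A // f x = b.as} :=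
  (piZeroHoFiber (disc f) b).trans <| (piZeroDiscrete A).subtypeEquiv <| by
    rintro ⟨x⟩
    exact (piZeroDiscrete B).injective.eq_iff.symm

theorem mapFinite_disc {A B : Type} {f : A → B} (hf : FiniteFibres f) : MapFinite (disc f) :=
  fun b => ⟨@Finite.of_equiv _ _ (hf b.as) (piZeroHoFiberDisc f b).symm, finite_aut⟩

theorem hoCard_hoFiber_disc {A B : Type} (f : A → B) (b : Discrete B) :
    hoCard (HoFiber (disc f) b) = Nat.card {x : A // f x = b.as} := by
  rw [hoCard_of_isThin, Nat.card_congr (piZeroHoFiberDisc f b)]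

variable (X : SimplicialMonoid)

theorem locallyFinite_toGrpd (h₀ : FiniteFibres (X.s (n := 0) 0))
    (h₁ : FiniteFibres (X.d (n := 1) 1)) : X.toGrpd.LocallyFinite :=
  ⟨fun (x : Discrete _) => finite_aut x, mapFinite_disc h₀, mapFinite_disc h₁⟩

/-- The basis element of the incidence bialgebra given by an element of degree `1`. -/
def basisElt (f : X.obj 1) : X.toGrpd.Inc := X.toGrpd.delta (⟨f⟩ : Discrete (X.obj 1))

theorem toTensor_comulCard (h₁ : FiniteFibres (X.d (n := 1) 1)) (f : Discrete (X.obj 1)) :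
    X.toGrpd.toTensor (X.toGrpd.comulCard f) = ∑ t ∈ h₁.fibre f.as,
      X.basisElt (X.d (n := 1) 2 t) ⊗ₜ[ℚ] X.basisElt (X.d (n := 1) 0 t) := by
  have : Finite {x // X.d (n := 1) 1 x = f.as} := h₁ f.as
  have : Fintype (PiZero (HoFiber (disc (X.d (n := 1) 1)) f)) :=
    @Fintype.ofFinite _ (Finite.of_equiv _ (piZeroHoFiberDisc _ f).symm)
  have h := hoCardMap_of_isThin (A := HoFiber (disc (X.d (n := 1) 1)) f)
    (CostructuredArrow.proj (disc (X.d (n := 1) 1)) f ⋙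
      (disc (X.d (n := 1) 2)).prod' (disc (X.d (n := 1) 0)))
  refine (congrArg X.toGrpd.toTensor h).trans ((map_sum X.toGrpd.toTensor _ _).trans ?_)
  refine Finset.sum_bij' (fun x _ => (piZeroHoFiberDisc _ f x).1)
    (fun t ht => (piZeroHoFiberDisc _ f).symm ⟨t, h₁.mem_fibre.1 ht⟩) ?_ ?_ ?_ ?_ ?_
  · exact fun x _ => h₁.mem_fibre.2 (piZeroHoFiberDisc _ f x).2
  · exact fun _ _ => Finset.mem_univ _
  · exact fun x _ => (piZeroHoFiberDisc _ f).symm_apply_apply x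
  · exact fun t ht => congrArg Subtype.val ((piZeroHoFiberDisc _ f).apply_symm_apply _)
  · rintro ⟨x⟩ _
    refine (Finsupp.linearCombination_single ℚ _ _).trans (one_smul _ _)

/-- Isomorphic objects of a discrete groupoid are equal, so the chosen representative is the object
itself; this evaluates `comul` and `counit`, which are defined through `out`. -/
theorem out_cls (f : X.obj 1) :
    (cls (⟨f⟩ : Discrete (X.obj 1)) : PiZero (X.toGrpd.obj 1)).out = (⟨f⟩ : Discrete (X.obj 1)) :=
  Discrete.ext ((piZeroDiscrete (X.obj 1)).symm.injective
    (cls_out (cls (⟨f⟩ : Discrete (X.obj 1)))))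

theorem comul_basisElt (h₁ : FiniteFibres (X.d (n := 1) 1)) (f : X.obj 1) :
    X.toGrpd.comul (X.basisElt f) = ∑ t ∈ h₁.fibre f,
      X.basisElt (X.d (n := 1) 2 t) ⊗ₜ[ℚ] X.basisElt (X.d (n := 1) 0 t) := by
  refine (Module.Basis.constr_basis (MonoidAlgebra.basis (PiZero (X.toGrpd.obj 1)) ℚ) ℚ
    (fun f => X.toGrpd.toTensor (X.toGrpd.comulCard f.out))
    (cls (⟨f⟩ : Discrete (X.obj 1)))).trans ?_
  rw [X.out_cls, X.toTensor_comulCard h₁]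

theorem counit_basisElt (f : X.obj 1) :
    X.toGrpd.counit (X.basisElt f) = Nat.card {x // X.s (n := 0) 0 x = f} := by
  refine (Module.Basis.constr_basis (MonoidAlgebra.basis (PiZero (X.toGrpd.obj 1)) ℚ) ℚ
    (fun f => hoCard (HoFiber (X.toGrpd.s (n := 0) 0) f.out))
    (cls (⟨f⟩ : Discrete (X.obj 1)))).trans ?_
  rw [X.out_cls]
  exact hoCard_hoFiber_disc _ _

/-- The monoid of components in degree `1` is the monoid of elements of degree `1`. -/
def piZeroEquiv : X.obj 1 ≃* PiZero (X.toGrpd.obj 1) where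
  toEquiv := (piZeroDiscrete (X.obj 1)).symm
  map_mul' _ _ := rfl

end SimplicialMonoid

open NSOperad

/-! ## Trees of height at most two in the bar construction -/

/-- The tree of height `1` given by a word. -/
def wordTree (w : Word) : (TT Ass).Tree 1 :=
  ⟨((TT Ass).src (wordOp w), wordOp w), List.map_id _⟩

theorem src_wordOp_length (w : Word) : ((TT Ass).src (wordOp w)).length = w.1.length := by
  change ((w.1.map assArrow).map Sigma.fst).length = _
  simp

/-- Two lists of colours of `TT Ass` of the same length are equal. -/
theorem cols_ext {l m : List (TT Ass).Col} (h : l.length = m.length) : l = m :=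
  List.ext_getElem h fun _ _ _ => Subsingleton.elim (α := Unit) _ _

/-- An arrow is an operation of `Ass`, and its arity determines it. -/
theorem assArrow_ext {f g : Σ c : Ass.TCat, c ⟶ assObj}
    (h : f.2.1.1.length = g.2.1.1.length) : f = g := by
  obtain ⟨⟨⟩, f⟩ := f
  obtain ⟨⟨⟩, g⟩ := g
  exact congrArg (Sigma.mk _) (Subtype.ext (Subtype.ext
    (List.ext_getElem h fun _ _ _ => Subsingleton.elim (α := Unit) _ _)))

theorem assArrow_length (n : ℕ+) : (assArrow n).2.1.1.length = n := List.length_replicate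

theorem assArrow_bijective : Function.Bijective assArrow := by
  constructor
  · intro m n h
    have := congrArg (fun f : Σ c : Ass.TCat, c ⟶ assObj => f.2.1.1.length) h
    simp only [assArrow_length] at this
    exact PNat.coe_injective this
  · intro f
    exact ⟨⟨f.2.1.1.length, List.length_pos_of_ne_nil f.2.1.2⟩, assArrow_ext (assArrow_length _)⟩

/-- Substituting an operation of arity `n` into each of `k` inputs gives arity `k * n`. This is
where the Verschiebung operators come from. -/
theorem assArrow_mul (k n : ℕ+) :
    (⟨(assArrow n).1, (assArrow n).2 ≫ (assArrow k).2⟩ : Σ c : Ass.TCat, c ⟶ assObj) =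
      assArrow (k * n) := by
  apply assArrow_ext
  rw [assArrow_length]
  have key : ∀ l : List Unit, ((l.map fun _ => assOp n).flatMap Subtype.val).length =
      l.length * n := by
    intro l
    induction l with
    | nil => exact (zero_mul _).symm
    | cons _ l ih =>
      refine List.length_append.trans ?_
      rw [List.length_cons, add_mul, one_mul, add_comm, ← ih]
      exact congrArg _ List.length_replicate
  refine (key _).trans ?_
  rw [PNat.mul_coe]
  exact congrArg (· * _) List.length_replicate

theorem wordOp_bijective : Function.Bijective wordOp := by
  constructor
  · intro v w h
    obtain ⟨-, h⟩ := Sigma.mk.inj h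
    exact Subtype.ext (List.map_injective_iff.2 assArrow_bijective.1
      (congrArg Subtype.val (eq_of_heq h)))
  · rintro ⟨⟨⟩, l, hl⟩
    obtain ⟨w, rfl⟩ := List.map_surjective_iff.2 assArrow_bijective.2 l
    exact ⟨⟨w, fun h => hl (by rw [h]; rfl)⟩, rfl⟩

/-- The leaves of a tree of height 1 carry only colours, which the operation prescribes. -/
theorem tree_ext {s t : (TT Ass).Tree 1} (h : s.1.2 = t.1.2) : s = t := by
  have hs : s.1.1 = (TT Ass).src s.1.2 := (List.map_id _).symm.trans s.2
  have ht : t.1.1 = (TT Ass).src t.1.2 := (List.map_id _).symm.trans t.2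
  exact Subtype.ext (Prod.ext (hs.trans ((congrArg _ h).trans ht.symm)) h)

theorem wordTree_bijective : Function.Bijective wordTree := by
  constructor
  · intro v w h
    exact wordOp_bijective.1 (congrArg (fun t : (TT Ass).Tree 1 => t.1.2) h)
  · intro t
    obtain ⟨w, hw⟩ := wordOp_bijective.2 t.1.2
    exact ⟨w, tree_ext hw⟩

/-- The tree of height `2` given by a decomposition. -/
def decTree (d : Dec) : (TT Ass).Tree 2 :=
  ⟨(d.inner.map wordTree, wordOp d.outer), cols_ext (by
    rw [src_wordOp_length]
    simp [Dec.inner, Dec.outer])⟩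

theorem decTree_bijective : Function.Bijective decTree := by
  constructor
  · intro d d' h
    obtain ⟨h₁, h₂⟩ := Prod.ext_iff.1 (congrArg Subtype.val h)
    exact Dec.pair_injective (Prod.ext (wordOp_bijective.1 h₂)
      (List.map_injective_iff.2 wordTree_bijective.1 h₁))
  · rintro ⟨⟨l, x⟩, h⟩
    obtain ⟨κ, rfl⟩ := List.map_surjective_iff.2 wordTree_bijective.2 l
    obtain ⟨ω, rfl⟩ := wordOp_bijective.2 x
    have hl : κ.length = ω.1.length := by
      have := congrArg List.length h
      rw [src_wordOp_length] at this
      simpa using this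
    have h₁ : (ω.1.zip κ).map Prod.fst = ω.1 := List.map_fst_zip hl.ge
    have h₂ : (ω.1.zip κ).map Prod.snd = κ := List.map_snd_zip hl.le
    refine ⟨⟨ω.1.zip κ, fun h => ω.2 (by rw [← h₁, h]; rfl)⟩, Subtype.ext (Prod.ext ?_ ?_)⟩
    · exact congrArg (List.map wordTree) h₂
    · exact congrArg wordOp (Subtype.ext h₁)

/-- Grafting `κᵢ` onto the arrow of arity `ωᵢ` multiplies the letters of `κᵢ` by `ωᵢ`, and the
results are concatenated. -/
theorem graft_wordOp (p : List (ℕ+ × Word))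
    (h : ((p.map Prod.snd).map wordOp).map Sigma.fst =
      ((p.map Prod.fst).map assArrow).map Sigma.fst) :
    graft ((p.map Prod.snd).map wordOp) ((p.map Prod.fst).map assArrow) h =
      (totalList p).map assArrow := by
  induction p with
  | nil => rfl
  | cons x p ih =>
    refine (congrArg (_ ++ ·) (ih (List.cons.inj h).2)).trans ?_
    rw [totalList_cons, List.map_append]
    refine congrArg (· ++ _) ?_
    change (x.2.1.map assArrow).map _ = (x.2.1.map _).map assArrow
    refine List.map_map.trans (Eq.trans ?_ List.map_map.symm)
    refine List.map_congr_left fun n _ => ?_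
    refine Eq.trans ?_ (assArrow_mul x.1 n)
    -- The transport `eqToHom` in `graft` is an identity, the category having a single object.
    exact congrArg (fun g => (⟨(assArrow n).1, (assArrow n).2 ≫ g⟩ : Σ c : Ass.TCat, c ⟶ assObj))
      (Category.id_comp _)

theorem mu_decTree (d : Dec) :
    Attach.mu (f := (TT Ass).root 0) (decTree d) = wordTree d.total := by
  apply tree_ext
  have h : (d.inner.map wordTree).map (fun y : (TT Ass).Tree 1 => y.1.2) = d.inner.map wordOp := by
    rw [List.map_map]
    rfl
  have h' : (d.inner.map wordOp).map (TT Ass).tgt = (TT Ass).src (wordOp d.outer) := cols_ext (by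
    rw [src_wordOp_length]
    simp [Dec.inner, Dec.outer])
  refine (comp_congr _ h' h rfl).trans ?_
  exact congrArg (Sigma.mk assObj) (Subtype.ext (graft_wordOp d.1 h'))

theorem face_decTree (d : Dec) : ((TT Ass).face 1 0).1 (decTree d) = wordTree d.outer := by
  rw [(TT Ass).face_le le_rfl]
  exact tree_ext rfl

theorem eta_unit (c : (TT Ass).Tree 0) :
    Attach.eta (f := (TT Ass).root 0) c = wordTree PLin.oneWord := by
  apply tree_ext
  exact congrArg (Sigma.mk assObj) (Subtype.ext (congrArg (fun f => [f]) (assArrow_ext rfl)))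

/-! ## The incidence bialgebra of the bar construction -/

/-- The forest of height `1` given by a sequence of words. -/
def forest (κ : List Word) : (TT Ass).bar.obj 1 := FreeMonoid.ofList (κ.map wordTree)

theorem forest_injective : Function.Injective forest :=
  List.map_injective_iff.2 wordTree_bijective.1

/-- The forest of height `2` given by a sequence of decompositions. -/
def forestTwo (q : List Dec) : (TT Ass).bar.obj 2 := FreeMonoid.ofList (q.map decTree)

theorem forestTwo_bijective : Function.Bijective forestTwo :=
  ⟨List.map_injective_iff.2 decTree_bijective.1, List.map_surjective_iff.2 decTree_bijective.2⟩

theorem forest_surjective : Function.Surjective forest :=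
  List.map_surjective_iff.2 wordTree_bijective.2

theorem d_one_forestTwo (q : List Dec) :
    (TT Ass).bar.d (n := 1) 1 (forestTwo q) = forest (q.map Dec.total) := by
  refine ((TT Ass).barFace_ofList_le le_rfl _).trans ?_
  rw [(TT Ass).face_last 0, List.map_map, forest, List.map_map]
  exact congrArg (fun g => FreeMonoid.ofList (q.map g)) (funext mu_decTree)

theorem d_zero_forestTwo (q : List Dec) :
    (TT Ass).bar.d (n := 1) 0 (forestTwo q) = forest (q.map Dec.outer) := by
  refine ((TT Ass).barFace_ofList_le (Nat.zero_le 1) _).trans ?_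
  rw [List.map_map, forest, List.map_map]
  exact congrArg (fun g => FreeMonoid.ofList (q.map g)) (funext face_decTree)

theorem d_two_forestTwo (q : List Dec) :
    (TT Ass).bar.d (n := 1) 2 (forestTwo q) = forest (q.flatMap Dec.inner) := by
  refine ((TT Ass).barFace_ofList_last 1 _).trans ?_
  rw [List.flatMap_map, forest, List.map_flatMap]
  rfl

/-- In degree 0 there are only sequences of the single colour, and its unit is the word `1`; hence
`s₀` is injective. -/
theorem s_zero_eq (x : (TT Ass).bar.obj 0) :
    (TT Ass).bar.s (n := 0) 0 x =
      forest (List.replicate (FreeMonoid.toList x).length PLin.oneWord) := by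
  rw [forest, List.map_replicate, ← List.map_const']
  exact congrArg (fun g => FreeMonoid.ofList ((FreeMonoid.toList x).map g)) (funext eta_unit)

theorem s_zero_injective : Function.Injective ((TT Ass).bar.s (n := 0) 0) := by
  intro x y h
  rw [s_zero_eq, s_zero_eq] at h
  have := congrArg List.length (forest_injective h)
  rw [List.length_replicate, List.length_replicate] at this
  exact cols_ext this

theorem finiteFibres_s_zero : FiniteFibres ((TT Ass).bar.s (n := 0) 0) := fun _ =>
  Set.Subsingleton.finite fun _ h _ h' => s_zero_injective (Eq.trans h (Eq.symm h'))

theorem finiteFibres_d_one : FiniteFibres ((TT Ass).bar.d (n := 1) 1) := by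
  intro f
  obtain ⟨κ, rfl⟩ := forest_surjective f
  refine ((Dec.finiteFibres_total.listMap κ).image forestTwo).subset fun t ht => ?_
  obtain ⟨q, rfl⟩ := forestTwo_bijective.2 t
  exact ⟨q, forest_injective ((d_one_forestTwo q).symm.trans ht), rfl⟩

theorem barTTAss_locallyFinite : barTTAss.LocallyFinite :=
  SimplicialMonoid.locallyFinite_toGrpd _ finiteFibres_s_zero finiteFibres_d_one

/-- The basis element given by a sequence of words. -/
def forestElt (κ : List Word) : barTTAss.Inc := (TT Ass).bar.basisElt (forest κ)

/-- The elements of degree 2 over a forest are the sequences of decompositions of its words, so the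
expansion is that of `PLin.comul_list`. -/
theorem comul_forestElt (κ : List Word) : barTTAss.comul (forestElt κ) =
    ∑ q ∈ Dec.finiteFibres_total.listMap.fibre κ,
      forestElt (q.flatMap Dec.inner) ⊗ₜ[ℚ] forestElt (q.map Dec.outer) := by
  refine ((TT Ass).bar.comul_basisElt finiteFibres_d_one (forest κ)).trans ?_
  symm
  refine Finset.sum_nbij forestTwo ?_ forestTwo_bijective.1.injOn ?_ ?_
  · intro q hq
    rw [FiniteFibres.mem_fibre] at hq ⊢
    rw [d_one_forestTwo, hq]
  · intro t ht
    obtain ⟨q, rfl⟩ := forestTwo_bijective.2 t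
    rw [Finset.mem_coe, FiniteFibres.mem_fibre, d_one_forestTwo] at ht
    exact ⟨q, by simpa using forest_injective ht, rfl⟩
  · intro q _
    rw [d_two_forestTwo, d_zero_forestTwo]
    rfl

/-- As `s₀` is injective, its fibre is a point or empty; it is a point exactly for forests of units.
-/
theorem counit_forestElt (κ : List Word) :
    barTTAss.counit (forestElt κ) = if ∀ w ∈ κ, w.1 = [1] then 1 else 0 := by
  refine ((TT Ass).bar.counit_basisElt (forest κ)).trans ?_
  have hs : Subsingleton {x // (TT Ass).bar.s (n := 0) 0 x = forest κ} :=
    ⟨fun x y => Subtype.ext (s_zero_injective (x.2.trans y.2.symm))⟩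
  split_ifs with h
  · have : Nonempty {x // (TT Ass).bar.s (n := 0) 0 x = forest κ} := by
      refine ⟨FreeMonoid.ofList (List.replicate κ.length ()), ?_⟩
      refine (s_zero_eq _).trans (congrArg forest ?_)
      change List.replicate (List.replicate κ.length ()).length _ = κ
      rw [List.length_replicate]
      exact (List.eq_replicate_iff.2 ⟨rfl, fun w hw => Subtype.ext (h w hw)⟩).symm
    rw [Nat.card_unique, Nat.cast_one]
  · have : IsEmpty {x // (TT Ass).bar.s (n := 0) 0 x = forest κ} := by
      refine ⟨fun ⟨x, hx⟩ => h fun w hw => ?_⟩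
      rw [s_zero_eq] at hx
      rw [← forest_injective hx] at hw
      rw [List.eq_of_mem_replicate hw]
      rfl
    rw [Nat.card_of_isEmpty, Nat.cast_zero]

/-! ### The isomorphism of bialgebras -/

/-- Forests of height `1` are sequences of words. -/
def forestEquiv : FreeMonoid Word ≃* PiZero (barTTAss.obj 1) :=
  (FreeMonoid.freeMonoidCongr (Equiv.ofBijective wordTree wordTree_bijective)).trans
    (TT Ass).bar.piZeroEquiv

/-- The isomorphism from the noncommutative linear plethystic bialgebra to the incidence
bialgebra of the bar construction. -/
def incEquiv : PLin ≃ₐ[ℚ] barTTAss.Inc :=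
  FreeAlgebra.equivMonoidAlgebraFreeMonoid.trans (MonoidAlgebra.domCongr ℚ ℚ forestEquiv)

theorem incEquiv_a (w : Word) : incEquiv (PLin.a w) = barTTAss.delta (connected w) := by
  have h : FreeAlgebra.equivMonoidAlgebraFreeMonoid (PLin.a w) =
      MonoidAlgebra.single (FreeMonoid.of w) (1 : ℚ) := FreeAlgebra.lift_ι_apply _ _
  rw [incEquiv, AlgEquiv.trans_apply, h]
  exact MonoidAlgebra.domCongr_single ..

theorem forestElt_cons (w : Word) (κ : List Word) :
    forestElt (w :: κ) = barTTAss.delta (connected w) * forestElt κ :=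
  ((MonoidAlgebra.single_mul_single (cls (connected w) : PiZero (barTTAss.obj 1))
    (cls (⟨forest κ⟩ : Discrete _) : PiZero (barTTAss.obj 1)) (1 : ℚ) 1).trans
      (congrArg _ (one_mul _))).symm

theorem incEquiv_list (κ : List Word) : incEquiv (κ.map PLin.a).prod = forestElt κ := by
  induction κ with
  | nil => exact map_one incEquiv
  | cons w κ ih => rw [List.map_cons, List.prod_cons, map_mul, ih, incEquiv_a, forestElt_cons]

/-- The comultiplication and counit of the incidence bialgebra are at this point only linear, so
comparing them on generators would not suffice; all monomials are needed. -/
theorem PLin.linearMap_ext {M : Type*} [AddCommGroup M] [Module ℚ M] {f g : PLin →ₗ[ℚ] M}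
    (h : ∀ κ : List Word, f (κ.map a).prod = g (κ.map a).prod) : f = g := by
  refine (FreeAlgebra.basisFreeMonoid ℚ Word).ext fun m => ?_
  have hm : FreeAlgebra.basisFreeMonoid ℚ Word m = ((FreeMonoid.toList m).map a).prod := by
    change MonoidAlgebra.lift ℚ PLin (FreeMonoid Word) (FreeMonoid.lift (FreeAlgebra.ι ℚ))
      (MonoidAlgebra.single m 1) = _
    rw [MonoidAlgebra.lift_single, one_smul, FreeMonoid.lift_apply]
    rfl
  rw [hm, h]

theorem comul_incEquiv (x : PLin) : barTTAss.comul (incEquiv x) =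
    TensorProduct.map incEquiv.toLinearMap incEquiv.toLinearMap (PLin.comul x) := by
  have : barTTAss.comul ∘ₗ incEquiv.toLinearMap =
      TensorProduct.map incEquiv.toLinearMap incEquiv.toLinearMap ∘ₗ PLin.comul.toLinearMap := by
    refine PLin.linearMap_ext fun κ => ?_
    simp only [LinearMap.comp_apply, AlgEquiv.toLinearMap_apply, AlgHom.toLinearMap_apply,
      incEquiv_list, comul_forestElt, PLin.comul_list, map_sum, TensorProduct.map_tmul]
  exact LinearMap.congr_fun this x

theorem counit_incEquiv (x : PLin) : barTTAss.counit (incEquiv x) = PLin.counit x := by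
  have : barTTAss.counit ∘ₗ incEquiv.toLinearMap = PLin.counit.toLinearMap := by
    refine PLin.linearMap_ext fun κ => ?_
    simp only [LinearMap.comp_apply, AlgEquiv.toLinearMap_apply, AlgHom.toLinearMap_apply,
      incEquiv_list, counit_forestElt, PLin.counit_list]
  exact LinearMap.congr_fun this x

end Pleth

end

theorem mainTheorem6 :
    Pleth.barTTAss.LocallyFinite ∧
    Pleth.IsBialgebra Pleth.PLin Pleth.PLin.comul.toLinearMap Pleth.PLin.counit.toLinearMap ∧
    Pleth.IsBialgebra Pleth.barTTAss.Inc Pleth.barTTAss.comul Pleth.barTTAss.counit ∧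
    (∃ e : Pleth.PLin ≃ₐ[ℚ] Pleth.barTTAss.Inc,
      (∀ x : Pleth.PLin, Pleth.barTTAss.comul (e x) =
        TensorProduct.map e.toLinearMap e.toLinearMap (Pleth.PLin.comul x)) ∧
      (∀ x : Pleth.PLin, Pleth.barTTAss.counit (e x) = Pleth.PLin.counit x) ∧
      (∀ ω : Pleth.Word,
        e (Pleth.PLin.a ω) = Pleth.barTTAss.delta (Pleth.connected ω))) ∧
    (∀ ν : Pleth.Word, (Pleth.decompositions ν).Finite ∧
      Pleth.PLin.comul (Pleth.PLin.a ν) =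
        ∑ᶠ p ∈ Pleth.decompositions ν,
          (p.2.map Pleth.PLin.a).prod ⊗ₜ[ℚ] Pleth.PLin.a p.1) ∧
    (∀ (R : Type*) [Ring R] [Algebra ℚ R] (F G : Pleth.Word → R) (ν : Pleth.Word),
      Pleth.evalPair F G (Pleth.PLin.comul (Pleth.PLin.a ν)) = Pleth.subst G F ν) :=
  ⟨Pleth.barTTAss_locallyFinite, Pleth.PLin.isBialgebra,
    -- The axioms on the incidence side, including multiplicativity of its comultiplication, are
    -- inherited from the free algebra.
    Pleth.PLin.isBialgebra.of_algEquiv Pleth.incEquiv Pleth.comul_incEquiv Pleth.counit_incEquiv,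
    ⟨Pleth.incEquiv, Pleth.comul_incEquiv, Pleth.counit_incEquiv, Pleth.incEquiv_a⟩,
    fun ν => ⟨Pleth.Dec.decompositions_finite ν, by
      rw [Pleth.PLin.comul_a, Pleth.Dec.finsum_decompositions]
      rfl⟩,
    fun _ _ _ F G ν => Pleth.PLin.evalPair_comul F G ν⟩
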